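/- Let $\operatorname{Im}\tau>0$, $q=e^{2\pi i\tau}$, and $q^z=e^{2\pi i\tau z}$ for $z\in\mathbb C$; let $n\ge 0$, $x_1,x_2\in\mathbb C^*$, $\beta_1,\beta_2,\gamma\in\mathbb C$. Write $(a;c)_m=\prod_{i=0}^{m-1}(1-ac^i)$, $(a)_\infty=\prod_{\nu\ge0}(1-q^\nu a)$ and $\mathcal A g(t)=\sum_{\sigma\in\mathfrak S_n}\operatorname{sgn}\sigma\; g(t_{\sigma(1)},\dots,t_{\sigma(n)})$. For $0\le s\le n$ let $$\psi_s(t)=\mathcal A\Big[\prod_{k=1}^n\frac1{1-t_k/x_1}\prod_{k=1}^{n-s}\frac{1-q^{\beta_1}t_k/x_1}{1-t_k/x_2}\prod_{1\le i<j\le n}(t_i-q^{-\gamma}t_j)\Big],$$ and let $\varphi_s$ be obtained from $\psi_s$ by exchanging $(x_1,\beta_1)$ with $(x_2,\beta_2)$. Assume that the parameters are generic in the following sense: $$q^{k\gamma}\ne1\ (1\le k\le n),\qquad \tfrac{x_2}{x_1}\ne q^{\beta_2+k\gamma}\ (0\le k<n),\qquad \tfrac{x_2}{x_1}q^{\beta_1-\beta_2+m\gamma}\ne1\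 (m\in\mathbb Z,\ |m|<n).$$ Then there is exactly one matrix $R_{2,1}(\frac{x_2}{x_1})$ of complex numbers, with rows and columns indexed by $0,\dots,n$, such that $$(\varphi_0(t),\varphi_1(t),\dots,\varphi_n(t))\,R_{2,1}(\tfrac{x_2}{x_1})=(\psi_n(t),\psi_{n-1}(t),\dots,\psi_0(t))$$ for all $t\in(\mathbb C^*)^n$ with $t_k\ne x_1,x_2$ for all $k$, and it has the Gauss decomposition $$R_{2,1}(\tfrac{x_2}{x_1})=U_R\cdot D_R\cdot L_R.$$ Here $U_R=(u_{rs})$ is upper triangular with unit diagonal, with, for $s\ge r$, $$u_{rs}=(-1)^{s-r}\big(\tfrac{x_2}{x_1}q^{-\beta_2}\big)^{s-r}q^{-(s-r)(s+r-1)\gamma/2}\,\frac{(q^\gamma;q^\gamma)_s}{(q^\gamma;q^\gamma)_{s-r}(q^\gamma;q^\gamma)_r}\,\frac{(q^{\beta_1+(n-s)\gamma};q^\gamma)_{s-r}}{(\frac{x_2}{x_1}q^{\beta_1-\beta_2+(n-2s+1)\gamma};q^\gamma)_{s-r}};$$ $D_R=\operatorname{diag}[d_0,\dots,d_n]$ with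 $$d_r=q^{-(n-r)\beta_2-r(n-r)\gamma}\,\frac{(\frac{x_2}{x_1}q^{\beta_1};q^\gamma)_{n-r}}{(\frac{x_2}{x_1}q^{-\beta_2-(r-1)\gamma};q^\gamma)_r}\,\frac{(\frac{x_2}{x_1}q^{\beta_1-\beta_2+(n-2r+1)\gamma};q^\gamma)_r}{(\frac{x_2}{x_1}q^{\beta_1-\beta_2-r\gamma};q^\gamma)_{n-r}};$$ and $L_R=(l_{rs})$ is lower triangular with unit diagonal, with, for $r\ge s$, $$l_{rs}=(-1)^{r-s}q^{\beta_2(s-r)}q^{-(r-s)(r+s-1)\gamma/2}\,\frac{(q^\gamma;q^\gamma)_{n-s}}{(q^\gamma;q^\gamma)_{r-s}(q^\gamma;q^\gamma)_{n-r}}\,\frac{(q^{\beta_2+s\gamma};q^\gamma)_{r-s}}{(\frac{x_2}{x_1}q^{\beta_1-\beta_2+(n-2r+1)\gamma};q^\gamma)_{r-s}}.$$ The same matrix relates the Jackson integrals. For $\alpha\in\mathbb C$ put $\alpha_j=\alpha-n+j-2(j-1)\gamma$ and $$\Phi(t)=\prod_{j=1}^n t_j^{\alpha_j}\prod_{j=1}^n\frac{(t_j/x_1)_\infty}{(q^{\beta_1}t_j/x_1)_\infty}\frac{(t_j/x_2)_\infty}{(q^{\beta_2}t_j/x_2)_\infty}\prod_{1\le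 i<j\le n}\frac{(q^{1-\gamma}t_j/t_i)_\infty}{(q^\gamma t_j/t_i)_\infty}.$$ For $\xi=(e^{u_1},\dots,e^{u_n})\in(\mathbb C^*)^n$ put $$\widetilde f(\xi)=(1-q)^n\sum_{\nu\in\mathbb Z^n}\Phi(q^{\nu_1}\xi_1,\dots,q^{\nu_n}\xi_n)\,f(q^{\nu_1}\xi_1,\dots,q^{\nu_n}\xi_n)$$ for $f=\varphi_s,\psi_s$, where $t_j^{\alpha_j}=e^{\alpha_j(u_j+2\pi i\tau\nu_j)}$ at $t_j=q^{\nu_j}\xi_j$, and where, at lattice points with some $t_j\in\{x_1,x_2\}$, the poles of $f$ are cancelled against the zeros of $\Phi$. If no denominator factor of $\Phi$ vanishes at a point of this lattice, and the series for $\widetilde\varphi_0(\xi),\dots,\widetilde\varphi_n(\xi)$ converge absolutely, then so do those for $\widetilde\psi_0(\xi),\dots,\widetilde\psi_n(\xi)$, and $$(\widetilde\varphi_0(\xi),\dots,\widetilde\varphi_n(\xi))\,U_RD_RL_R=(\widetilde\psi_n(\xi),\dots,\widetilde\psi_0(\xi)).$$ -/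

import Mathlib

/-- The complex power `q ^ z := exp (2 π i τ z)` of the base `q = exp (2 π i τ)`. -/
noncomputable def qpow (τ z : ℂ) : ℂ :=
  Complex.exp (2 * (Real.pi : ℂ) * Complex.I * τ * z)

/-- The infinite product `(a)_∞ = (a; q)_∞ = ∏_{ν ≥ 0} (1 - q ^ ν a)`. -/
noncomputable def qInf (τ a : ℂ) : ℂ :=
  ∏' ν : ℕ, (1 - qpow τ (ν : ℂ) * a)

/-- The finite shifted factorial `(a; c)_m = (1 - a) (1 - a c) ⋯ (1 - a c ^ (m - 1))`. -/
noncomputable def poch (a c : ℂ) (m : ℕ) : ℂ :=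
  ∏ i ∈ Finset.range m, (1 - a * c ^ i)

/-- The factor `∏_{i < j} (t_i - q ^ {-γ} t_j)`. -/
noncomputable def deltaGamma (τ γ : ℂ) {n : ℕ} (t : Fin n → ℂ) : ℂ :=
  ∏ i : Fin n, ∏ j : Fin n, if i < j then t i - qpow τ (-γ) * t j else 1

/-- The alternating sum `𝒜 g (t) = ∑_σ sgn σ · g (t_{σ 1}, …, t_{σ n})`. -/
noncomputable def altSum {n : ℕ} (g : (Fin n → ℂ) → ℂ) (t : Fin n → ℂ) : ℂ :=
  ∑ σ : Equiv.Perm (Fin n), ((Equiv.Perm.sign σ : ℤ) : ℂ) * g (fun k => t (σ k))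

/-- Matsuo's rational function
`ψ_{(s, n - s)} [x₁, x₂; β₁, β₂] (t₁, …, t_n)` (the parameter `β₂` does not occur in it):
`𝒜 [∏_{k ≤ n} 1 / (1 - t_k / x₁) · ∏_{k ≤ n - s} (1 - q^{β₁} t_k / x₁) / (1 - t_k / x₂)
· ∏_{i < j} (t_i - q^{-γ} t_j)]`. -/
noncomputable def matsuo (τ γ x₁ x₂ β₁ : ℂ) {n : ℕ} (s : ℕ) : (Fin n → ℂ) → ℂ :=
  altSum fun t =>
    (∏ k : Fin n, 1 / (1 - t k / x₁)) *
    (∏ k : Fin n, if (k : ℕ) < n - s then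
      (1 - qpow τ β₁ * t k / x₁) / (1 - t k / x₂) else 1) *
    deltaGamma τ γ t

/-- The basis `ψ_s`. -/
noncomputable def psi (τ γ x₁ x₂ β₁ _β₂ : ℂ) {n : ℕ} (s : ℕ) (t : Fin n → ℂ) : ℂ :=
  matsuo τ γ x₁ x₂ β₁ s t

/-- The basis `φ_s`, obtained from `ψ_s` by exchanging `(x₁, β₁)` and `(x₂, β₂)`. -/
noncomputable def phi (τ γ x₁ x₂ β₁ β₂ : ℂ) {n : ℕ} (s : ℕ) (t : Fin n → ℂ) : ℂ :=
  psi τ γ x₂ x₁ β₂ β₁ s t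

/-- `R` is a matrix `R_{2,1}`: the identity of rational functions
`(φ_0, φ_1, …, φ_n) R = (ψ_n, ψ_{n-1}, …, ψ_0)` holds on `(ℂ^*)^n` off the poles `t_k = x₁, x₂`. -/
def IsRMatrix (τ γ x₁ x₂ β₁ β₂ : ℂ) (n : ℕ)
    (R : Matrix (Fin (n + 1)) (Fin (n + 1)) ℂ) : Prop :=
  ∀ t : Fin n → ℂ, (∀ k, t k ≠ 0 ∧ t k ≠ x₁ ∧ t k ≠ x₂) →
    ∀ s : Fin (n + 1),
      ∑ r : Fin (n + 1), phi τ γ x₁ x₂ β₁ β₂ (r : ℕ) t * R r s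
        = psi τ γ x₁ x₂ β₁ β₂ (n - (s : ℕ)) t

/-- The upper triangular factor, `X = x₂ / x₁`. -/
noncomputable def gaussU (τ γ β₁ β₂ X : ℂ) (n : ℕ) :
    Matrix (Fin (n + 1)) (Fin (n + 1)) ℂ :=
  Matrix.of fun i j =>
    let r : ℕ := i
    let s : ℕ := j
    if r ≤ s then
      (-1) ^ (s - r) * (X * qpow τ (-β₂)) ^ (s - r) *
        qpow τ (-(((s : ℂ) - r) * ((s : ℂ) + r - 1) * γ / 2)) *
        (poch (qpow τ γ) (qpow τ γ) s /
          (poch (qpow τ γ) (qpow τ γ) (s - r) * poch (qpow τ γ) (qpow τ γ) r)) *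
        (poch (qpow τ (β₁ + ((n : ℂ) - s) * γ)) (qpow τ γ) (s - r) /
          poch (X * qpow τ (β₁ - β₂ + ((n : ℂ) - 2 * s + 1) * γ)) (qpow τ γ) (s - r))
    else 0

/-- The diagonal entries `d_r`, `0 ≤ r ≤ n`. -/
noncomputable def gaussDEntry (τ γ β₁ β₂ X : ℂ) (n r : ℕ) : ℂ :=
  qpow τ (-(((n : ℂ) - r) * β₂) - (r : ℂ) * ((n : ℂ) - r) * γ) *
    (poch (X * qpow τ β₁) (qpow τ γ) (n - r) /
      poch (X * qpow τ (-β₂ - ((r : ℂ) - 1) * γ)) (qpow τ γ) r) *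
    (poch (X * qpow τ (β₁ - β₂ + ((n : ℂ) - 2 * r + 1) * γ)) (qpow τ γ) r /
      poch (X * qpow τ (β₁ - β₂ - (r : ℂ) * γ)) (qpow τ γ) (n - r))

/-- The diagonal factor. -/
noncomputable def gaussD (τ γ β₁ β₂ X : ℂ) (n : ℕ) :
    Matrix (Fin (n + 1)) (Fin (n + 1)) ℂ :=
  Matrix.diagonal fun r => gaussDEntry τ γ β₁ β₂ X n (r : ℕ)

/-- The lower triangular factor. -/
noncomputable def gaussL (τ γ β₁ β₂ X : ℂ) (n : ℕ) :
    Matrix (Fin (n + 1)) (Fin (n + 1)) ℂ :=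
  Matrix.of fun i j =>
    let r : ℕ := i
    let s : ℕ := j
    if s ≤ r then
      (-1) ^ (r - s) * qpow τ (β₂ * ((s : ℂ) - r)) *
        qpow τ (-(((r : ℂ) - s) * ((r : ℂ) + s - 1) * γ / 2)) *
        (poch (qpow τ γ) (qpow τ γ) (n - s) /
          (poch (qpow τ γ) (qpow τ γ) (r - s) * poch (qpow τ γ) (qpow τ γ) (n - r))) *
        (poch (qpow τ (β₂ + (s : ℂ) * γ)) (qpow τ γ) (r - s) /
          poch (X * qpow τ (β₁ - β₂ + ((n : ℂ) - 2 * r + 1) * γ)) (qpow τ γ) (r - s))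
    else 0

/-- The Jackson integral over the lattice `⟨ξ⟩`. The multivalued powers `t_j ^ {α_j}` make the
integrand a function of a logarithm `u` of `t`, so functions are written in `u`, `t_j = exp u_j`:
the point `ξ` is `exp u`, and the lattice point `(q^{ν_1} ξ_1, …, q^{ν_n} ξ_n)` is
`exp (u + 2 π i τ ν)`. -/
noncomputable def jackson (τ : ℂ) {n : ℕ} (f : (Fin n → ℂ) → ℂ) (u : Fin n → ℂ) : ℂ :=
  (1 - qpow τ 1) ^ n *
    ∑' ν : Fin n → ℤ, f (fun j => u j + 2 * (Real.pi : ℂ) * Complex.I * τ * (ν j : ℂ))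

/-- Absolute convergence of the Jackson integral. -/
def JacksonSummable (τ : ℂ) {n : ℕ} (f : (Fin n → ℂ) → ℂ) (u : Fin n → ℂ) : Prop :=
  Summable fun ν : Fin n → ℤ =>
    f (fun j => u j + 2 * (Real.pi : ℂ) * Complex.I * τ * (ν j : ℂ))

/-- The factor `t_1^{α_1} ⋯ t_n^{α_n} ∏_{i < j} (q^{1-γ} t_j / t_i)_∞ / (q^γ t_j / t_i)_∞`,
`α_j = α - n + j - 2 (j - 1) γ` for `1 ≤ j ≤ n`. -/
noncomputable def PhiCommon (τ γ α : ℂ) {n : ℕ} (u : Fin n → ℂ) : ℂ :=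
  (∏ j : Fin n, Complex.exp
    ((α - n + ((j : ℕ) + 1 : ℂ) - 2 * ((j : ℕ) : ℂ) * γ) * u j)) *
  ∏ i : Fin n, ∏ j : Fin n, if i < j then
    qInf τ (qpow τ (1 - γ) * (Complex.exp (u j) / Complex.exp (u i))) /
      qInf τ (qpow τ γ * (Complex.exp (u j) / Complex.exp (u i))) else 1

/-- The `q`-multiplicative function `Φ = Φ_{n,2}`. -/
noncomputable def Phi (τ γ α x₁ x₂ β₁ β₂ : ℂ) {n : ℕ} (u : Fin n → ℂ) : ℂ :=
  PhiCommon τ γ α u *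
    ∏ j : Fin n,
      (qInf τ (Complex.exp (u j) / x₁) / qInf τ (qpow τ β₁ * (Complex.exp (u j) / x₁))) *
      (qInf τ (Complex.exp (u j) / x₂) / qInf τ (qpow τ β₂ * (Complex.exp (u j) / x₂)))

/-- `Φ` divided by `∏_j (1 - t_j / x₁) (1 - t_j / x₂)`, without the removable singularities. -/
noncomputable def PhiReg (τ γ α x₁ x₂ β₁ β₂ : ℂ) {n : ℕ} (u : Fin n → ℂ) : ℂ :=
  PhiCommon τ γ α u *
    ∏ j : Fin n,
      (qInf τ (qpow τ 1 * (Complex.exp (u j) / x₁)) /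
        qInf τ (qpow τ β₁ * (Complex.exp (u j) / x₁))) *
      (qInf τ (qpow τ 1 * (Complex.exp (u j) / x₂)) /
        qInf τ (qpow τ β₂ * (Complex.exp (u j) / x₂)))

/-- `ψ_{(s, n - s)}` multiplied by `∏_j (1 - t_j / x₁) (1 - t_j / x₂)`, as a polynomial. -/
noncomputable def matsuoNum (τ γ x₁ x₂ β₁ : ℂ) {n : ℕ} (s : ℕ) : (Fin n → ℂ) → ℂ :=
  altSum fun t =>
    (∏ k : Fin n, if (k : ℕ) < n - s then
      1 - qpow τ β₁ * t k / x₁ else 1 - t k / x₂) *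
    deltaGamma τ γ t

/-- The integrand `Φ ψ_s`. The simple poles of `ψ_s` along `t_j = x_k` are cancelled by zeros
of `Φ`, and the product is extended there by continuity. -/
noncomputable def PhiPsi (τ γ α x₁ x₂ β₁ β₂ : ℂ) {n : ℕ} (s : ℕ) (u : Fin n → ℂ) : ℂ :=
  PhiReg τ γ α x₁ x₂ β₁ β₂ u * matsuoNum τ γ x₁ x₂ β₁ s (fun j => Complex.exp (u j))

/-- The integrand `Φ φ_s`, extended in the same way. -/
noncomputable def PhiPhi (τ γ α x₁ x₂ β₁ β₂ : ℂ) {n : ℕ} (s : ℕ) (u : Fin n → ℂ) : ℂ :=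
  PhiReg τ γ α x₁ x₂ β₁ β₂ u * matsuoNum τ γ x₂ x₁ β₂ s (fun j => Complex.exp (u j))

/-- No point of the lattice through `exp u` is a pole of `Φ`, i.e. no denominator
`(q^{β_k} t_j / x_k)_∞` or `(q^γ t_j / t_i)_∞`, `i < j`, vanishes on it. -/
def LatticeAvoidsPoles (τ γ x₁ x₂ β₁ β₂ : ℂ) {n : ℕ} (u : Fin n → ℂ) : Prop :=
  ∀ m : ℤ,
    (∀ j, qpow τ (β₁ + m) * Complex.exp (u j) ≠ x₁) ∧
    (∀ j, qpow τ (β₂ + m) * Complex.exp (u j) ≠ x₂) ∧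
    (∀ i j, i < j → qpow τ (γ + m) * Complex.exp (u j) ≠ Complex.exp (u i))

lemma qInf_eq (τ a : ℂ) (hτ : 0 < τ.im) :
    qInf τ a = (1 - a) * qInf τ (qpow τ 1 * a) := by
  have hq : ∀ ν : ℕ, qpow τ (ν : ℂ) = qpow τ 1 ^ ν := by
    intro ν
    rw [qpow, qpow, ← Complex.exp_nat_mul]
    congr 1
    ring
  have hlt : ‖qpow τ 1‖ < 1 := by
    rw [qpow, Complex.norm_exp, Real.exp_lt_one_iff]
    have : (2 * (Real.pi : ℂ) * Complex.I * τ * 1).re = -(2 * Real.pi * τ.im) := by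
      simp
    rw [this]
    have := Real.pi_pos
    simp only [neg_lt_zero]
    positivity
  have hm : ∀ b : ℂ, Multipliable fun ν : ℕ => 1 - qpow τ (ν : ℂ) * b := by
    intro b
    simp only [hq, sub_eq_add_neg]
    apply multipliable_one_add_of_summable
    simp only [norm_neg, norm_mul, norm_pow]
    exact (summable_geometric_of_lt_one (norm_nonneg _) hlt).mul_right _
  have h1 : ∀ ν : ℕ, 1 - qpow τ ((ν + 1 : ℕ) : ℂ) * a
      = 1 - qpow τ (ν : ℂ) * (qpow τ 1 * a) := by
    intro ν
    rw [hq, hq, pow_succ]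
    ring
  unfold qInf
  rw [tprod_eq_zero_mul' (by simpa only [h1] using hm (qpow τ 1 * a))]
  simp only [h1]
  simp [qpow]

lemma PhiReg_mul (τ γ α x₁ x₂ β₁ β₂ : ℂ) {n : ℕ} (u : Fin n → ℂ) (hτ : 0 < τ.im) :
    Phi τ γ α x₁ x₂ β₁ β₂ u = PhiReg τ γ α x₁ x₂ β₁ β₂ u *
      ∏ j : Fin n, (1 - Complex.exp (u j) / x₁) * (1 - Complex.exp (u j) / x₂) := by
  unfold Phi PhiReg
  rw [mul_assoc, ← Finset.prod_mul_distrib]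
  congr 1
  refine Finset.prod_congr rfl fun j _ => ?_
  rw [qInf_eq τ (Complex.exp (u j) / x₁) hτ, qInf_eq τ (Complex.exp (u j) / x₂) hτ]
  ring

lemma matsuoNum_eq (τ γ x₁ x₂ β₁ : ℂ) {n : ℕ} (s : ℕ) (t : Fin n → ℂ)
    (ht : ∀ k, 1 - t k / x₁ ≠ 0 ∧ 1 - t k / x₂ ≠ 0) :
    matsuoNum τ γ x₁ x₂ β₁ s t =
      (∏ j : Fin n, (1 - t j / x₁) * (1 - t j / x₂)) * matsuo τ γ x₁ x₂ β₁ s t := by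
  unfold matsuoNum matsuo altSum
  rw [Finset.mul_sum]
  refine Finset.sum_congr rfl fun σ _ => ?_
  rw [← Equiv.prod_comp σ (fun j => (1 - t j / x₁) * (1 - t j / x₂))]
  beta_reduce
  rw [mul_left_comm (∏ j : Fin n, _), ← mul_assoc (∏ j : Fin n, _), ← mul_assoc (∏ j : Fin n, _),
    ← Finset.prod_mul_distrib, ← Finset.prod_mul_distrib]
  refine congrArg (_ * ·) (congrArg (· * _) ?_)
  refine Finset.prod_congr rfl fun k _ => ?_
  obtain ⟨h1, h2⟩ := ht (σ k)
  split_ifs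
  · have h : ∀ a b c : ℂ, a ≠ 0 → b ≠ 0 → c = a * b * (1 / a) * (c / b) := by
      intro a b c ha hb
      field_simp
    exact h _ _ _ h1 h2
  · have h : ∀ a b : ℂ, a ≠ 0 → b = a * b * (1 / a) * 1 := by
      intro a b ha
      field_simp
    exact h _ _ h1

/-- Off the hypersurfaces `t_j = x_k`, `PhiPsi` is the product of `Φ` and `ψ_s`. -/
lemma PhiPsi_eq (τ γ α x₁ x₂ β₁ β₂ : ℂ) {n : ℕ} (s : ℕ) (u : Fin n → ℂ) (hτ : 0 < τ.im)
    (hu : ∀ k, 1 - Complex.exp (u k) / x₁ ≠ 0 ∧ 1 - Complex.exp (u k) / x₂ ≠ 0) :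
    PhiPsi τ γ α x₁ x₂ β₁ β₂ s u =
      Phi τ γ α x₁ x₂ β₁ β₂ u * psi τ γ x₁ x₂ β₁ β₂ s (fun j => Complex.exp (u j)) := by
  rw [PhiPsi, PhiReg_mul _ _ _ _ _ _ _ _ hτ, matsuoNum_eq _ _ _ _ _ _ _ hu, psi, mul_assoc]

/-- Off the hypersurfaces `t_j = x_k`, `PhiPhi` is the product of `Φ` and `φ_s`. -/
lemma PhiPhi_eq (τ γ α x₁ x₂ β₁ β₂ : ℂ) {n : ℕ} (s : ℕ) (u : Fin n → ℂ) (hτ : 0 < τ.im)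
    (hu : ∀ k, 1 - Complex.exp (u k) / x₁ ≠ 0 ∧ 1 - Complex.exp (u k) / x₂ ≠ 0) :
    PhiPhi τ γ α x₁ x₂ β₁ β₂ s u =
      Phi τ γ α x₁ x₂ β₁ β₂ u * phi τ γ x₁ x₂ β₁ β₂ s (fun j => Complex.exp (u j)) := by
  rw [PhiPhi, PhiReg_mul _ _ _ _ _ _ _ _ hτ,
    matsuoNum_eq _ _ _ _ _ _ _ (fun k => ⟨(hu k).2, (hu k).1⟩), phi, psi, mul_assoc]
  simp only [mul_comm (1 - Complex.exp _ / x₂)]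

/-! Write c = q^γ, X = x₂/x₁ and Δ = ∏_{i<j} (t_i - q^{-γ} t_j), with indices starting at 0.
Multiplied by ∏_j (1 - t_j/x₁)(1 - t_j/x₂), every φ_r and ψ_s becomes 𝒜[∏_k (1 - a_k t_k) · Δ] with
constants a_k. Exchanging adjacent variables shows that 𝒜[∏_{k ∈ S} t_k · Δ] depends on S only
through |S| and an explicit power of c (`altMonomial_eq`). So each numerator is the image of the
one-variable polynomial ∏_k (1 - a_k c^{-k} z) under a linear functional that does not depend on the
a_k (`altLinear_linear`), and the transition matrix can be computed on polynomials.

In a rescaled variable w, φ_r corresponds to (q^{β₂} c^r w; c)_{n-r} (X w; c)_r and ψ_{n-s} to (w;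
c)_{n-s} (q^{β₁} X c^{n-s} w; c)_s. The intermediate basis (q^{β₂} c^s w; c)_{n-s} (q^{β₁} X c^{n-s}
w; c)_s produces the Gauss decomposition: passing from φ to it changes one factor and is upper
triangular (`poch_expansion_left`, `sum_mul_gaussU`); passing from it to ψ changes the other and is
lower triangular (`poch_expansion_right`, `sum_mul_gaussL`); the scalars left over form D. Both
expansions follow by induction from the two Pascal rules.

For uniqueness, at t_k = z c^{-k} only the identity permutation survives, so a relation between the
φ_r is a relation between their polynomials, and these are triangular with respect to the points w =
(X c^m)^{-1}. For the Jackson integrals, the identity of numerators holds at every t, also on t_j =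
x_k, and is summed over the lattice against the regularised Φ. -/

lemma qpow_add (τ a b : ℂ) : qpow τ (a + b) = qpow τ a * qpow τ b := by
  simp only [qpow, ← Complex.exp_add]
  congr 1
  ring

lemma qpow_neg (τ a : ℂ) : qpow τ (-a) = (qpow τ a)⁻¹ := by
  simp only [qpow, ← Complex.exp_neg]
  congr 1
  ring

lemma qpow_sub (τ a b : ℂ) : qpow τ (a - b) = qpow τ a / qpow τ b := by
  rw [sub_eq_add_neg, qpow_add, qpow_neg, div_eq_mul_inv]

lemma qpow_natCast_mul (τ a : ℂ) (k : ℕ) : qpow τ (k * a) = qpow τ a ^ k := by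
  simp only [qpow, ← Complex.exp_nat_mul]
  congr 1
  ring

lemma qpow_ne_zero (τ a : ℂ) : qpow τ a ≠ 0 := Complex.exp_ne_zero _

/-! ### Alternating sums against ∏_{i<j} (t_i - q^{-γ} t_j), and their reduction to one variable. -/

section AlternatingSums

variable {n : ℕ}

lemma altSum_smul (a : ℂ) (g : (Fin n → ℂ) → ℂ) (t : Fin n → ℂ) :
    altSum (fun t => a * g t) t = a * altSum g t := by
  unfold altSum
  rw [Finset.mul_sum]
  exact Finset.sum_congr rfl fun σ _ => by ring

lemma altSum_sum {ι : Type*} (s : Finset ι) (g : ι → (Fin n → ℂ) → ℂ) (t : Fin n → ℂ) :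
    altSum (fun t => ∑ i ∈ s, g i t) t = ∑ i ∈ s, altSum (g i) t := by
  unfold altSum
  simp only [Finset.mul_sum]
  rw [Finset.sum_comm]

/-- The alternating sum of a function invariant under a transposition vanishes. -/
lemma altSum_eq_zero_of_swap {i j : Fin n} (hij : i ≠ j) {g : (Fin n → ℂ) → ℂ}
    (hg : ∀ t, g (fun k => t (Equiv.swap i j k)) = g t) (t : Fin n → ℂ) : altSum g t = 0 := by
  have h : altSum g t = -altSum g t := by
    conv_lhs => unfold altSum
    -- Replacing σ by σ ∘ (i j) flips the sign and leaves the value of g unchanged.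
    rw [← Equiv.sum_comp (Equiv.mulRight (Equiv.swap i j)), altSum, ← Finset.sum_neg_distrib]
    refine Finset.sum_congr rfl fun σ _ => ?_
    have := hg fun k => t (σ k)
    simp only [Equiv.coe_mulRight, Equiv.Perm.sign_mul, Equiv.Perm.sign_swap hij,
      Equiv.Perm.mul_apply, this]
    simp
  exact self_eq_neg.mp h

/-- No index lies strictly between i and j = i + 1, so only the pair (i, j) itself is reversed. -/
lemma swap_lt_swap {i j a b : Fin n} (hij : (j : ℕ) = i + 1) (hab : a < b)
    (hne : ¬ (a = i ∧ b = j)) : Equiv.swap i j a < Equiv.swap i j b := by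
  simp only [Equiv.swap_apply_def]
  simp only [Fin.lt_def, Fin.ext_iff] at *
  split_ifs <;> omega

/-- Up to the factor of the pair `(i, i + 1)`, `∏_{i < j} (t_i - q^{-γ} t_j)` is invariant under
the exchange of `t_i` and `t_{i + 1}`. -/
lemma deltaGamma_swap (τ γ : ℂ) {i j : Fin n} (hij : (j : ℕ) = i + 1) (t : Fin n → ℂ) :
    deltaGamma τ γ (fun k => t (Equiv.swap i j k)) * (t i - qpow τ (-γ) * t j) =
      deltaGamma τ γ t * (t j - qpow τ (-γ) * t i) := by
  have hlt : i < j := by rw [Fin.lt_def]; omega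
  let S : Finset (Fin n × Fin n) := Finset.univ.filter fun p => p.1 < p.2
  have hS : (i, j) ∈ S := by simp [S, hlt]
  have key : ∀ t : Fin n → ℂ, deltaGamma τ γ t = (t i - qpow τ (-γ) * t j) *
      ∏ p ∈ S.erase (i, j), (t p.1 - qpow τ (-γ) * t p.2) := by
    intro t
    rw [Finset.mul_prod_erase S (fun p => t p.1 - qpow τ (-γ) * t p.2) hS, deltaGamma,
      ← Fintype.prod_prod_type' (fun a b => if a < b then t a - qpow τ (-γ) * t b else 1),
      Finset.prod_filter]
  -- The adjacent transposition permutes the ordered pairs other than (i, j).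
  have hinv : ∏ p ∈ S.erase (i, j),
        (t (Equiv.swap i j p.1) - qpow τ (-γ) * t (Equiv.swap i j p.2)) =
      ∏ p ∈ S.erase (i, j), (t p.1 - qpow τ (-γ) * t p.2) := by
    have hmem : ∀ p ∈ S.erase (i, j),
        (Equiv.swap i j p.1, Equiv.swap i j p.2) ∈ S.erase (i, j) := by
      rintro ⟨a, b⟩ hp
      simp only [S, Finset.mem_erase, Finset.mem_filter, Finset.mem_univ, true_and, ne_eq,
        Prod.mk.injEq] at hp ⊢
      refine ⟨?_, swap_lt_swap hij hp.2 hp.1⟩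
      rintro ⟨h1, h2⟩
      rw [Equiv.swap_apply_eq_iff, Equiv.swap_apply_left] at h1
      rw [Equiv.swap_apply_eq_iff, Equiv.swap_apply_right] at h2
      exact absurd hp.2 (by rw [h1, h2]; exact hlt.asymm)
    exact Finset.prod_nbij' (fun p => (Equiv.swap i j p.1, Equiv.swap i j p.2))
      (fun p => (Equiv.swap i j p.1, Equiv.swap i j p.2)) hmem hmem (by simp) (by simp) (by simp)
  rw [key t, key fun k => t (Equiv.swap i j k), hinv]
  simp only [Equiv.swap_apply_left, Equiv.swap_apply_right]
  ring

/-- `𝒜 [∏_{k ∈ S} t_k · ∏_{i < j} (t_i - q^{-γ} t_j)]`. -/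
noncomputable def altMonomial (τ γ : ℂ) (S : Finset (Fin n)) : (Fin n → ℂ) → ℂ :=
  altSum fun t => (∏ k ∈ S, t k) * deltaGamma τ γ t

/-- The difference of the two sides is the alternating sum of ∏_{k ∈ S} t_k · Δ · (t_j - q^{-γ}
t_i). By `deltaGamma_swap` this function is symmetric in t_i and t_j, so its alternating sum
vanishes. -/
lemma altMonomial_insert_succ (τ γ : ℂ) {i j : Fin n} (hij : (j : ℕ) = i + 1)
    {S : Finset (Fin n)} (hi : i ∉ S) (hj : j ∉ S) (t : Fin n → ℂ) :
    altMonomial τ γ (insert j S) t = qpow τ (-γ) * altMonomial τ γ (insert i S) t := by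
  have hne : i ≠ j := by rintro rfl; omega
  rw [← sub_eq_zero]
  have h0 := altSum_eq_zero_of_swap hne
    (g := fun t => (∏ k ∈ S, t k) * (deltaGamma τ γ t * (t j - qpow τ (-γ) * t i))) (by
      intro t
      have hS : ∏ k ∈ S, t (Equiv.swap i j k) = ∏ k ∈ S, t k :=
        Finset.prod_congr rfl fun k hk => by
          rw [Equiv.swap_apply_of_ne_of_ne (ne_of_mem_of_not_mem hk hi)
            (ne_of_mem_of_not_mem hk hj)]
      simp only [hS, Equiv.swap_apply_left, Equiv.swap_apply_right]
      rw [deltaGamma_swap τ γ hij]) t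
  rw [← h0]
  unfold altMonomial
  rw [← altSum_smul]
  unfold altSum
  rw [← Finset.sum_sub_distrib]
  refine Finset.sum_congr rfl fun σ _ => ?_
  simp only [Finset.prod_insert hi, Finset.prod_insert hj]
  ring

/-- A finite subset of `Fin n` which is not an initial segment contains some `i + 1` without
containing `i`. -/
lemma eq_filter_lt_card_or_exists_gap (S : Finset (Fin n)) :
    S = Finset.univ.filter (fun k : Fin n => (k : ℕ) < S.card) ∨
      ∃ i j : Fin n, (j : ℕ) = i + 1 ∧ i ∉ S ∧ j ∈ S := by
  by_cases h : ∃ i j : Fin n, (j : ℕ) = i + 1 ∧ i ∉ S ∧ j ∈ S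
  · exact Or.inr h
  left
  push Not at h
  -- Without gaps S is closed downwards, so k ∈ S forces k + 1 ≤ |S|.
  have hdown : ∀ d : ℕ, ∀ i j : Fin n, (j : ℕ) = i + d → j ∈ S → i ∈ S := by
    intro d
    induction d with
    | zero => intro i j hij hj; rwa [show i = j from Fin.ext (by omega)]
    | succ d ih =>
      intro i j hij hj
      by_contra hi
      have hlt : (i : ℕ) + 1 < n := by omega
      exact h i ⟨i + 1, hlt⟩ rfl hi (ih ⟨i + 1, hlt⟩ j (by simp only; omega) hj)
  have hsub : ∀ k ∈ S, (k : ℕ) < S.card := by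
    intro k hk
    have : Finset.Iic k ⊆ S := fun i hi =>
      hdown (k - i) i k (by have := Finset.mem_Iic.mp hi; rw [Fin.le_def] at this; omega) hk
    have := Finset.card_le_card this
    rw [Fin.card_Iic] at this
    omega
  refine Finset.eq_of_subset_of_card_le (fun k hk => by simpa using hsub k hk) ?_
  rw [Fin.card_filter_val_lt]
  exact min_le_right _ _

/-- `𝒜 [∏_{k ∈ S} t_k · Δ]` depends only on the size of `S`, up to a power of `q^γ`. -/
lemma altMonomial_eq (τ γ : ℂ) (S : Finset (Fin n)) (t : Fin n → ℂ) :
    altMonomial τ γ S t = (∏ k ∈ S, qpow τ (-γ) ^ (k : ℕ)) *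
      (qpow τ γ ^ (∑ k ∈ Finset.range S.card, k) *
        altMonomial τ γ (Finset.univ.filter fun k : Fin n => (k : ℕ) < S.card) t) := by
  -- Induction on the sum of the elements of S: as long as S has a gap, some i + 1 ∈ S can be moved
  -- down to i ∉ S, at the cost of one factor q^{-γ}.
  induction hN : ∑ k ∈ S, (k : ℕ) using Nat.strong_induction_on generalizing S with
  | _ N ih =>
  rcases eq_filter_lt_card_or_exists_gap S with hS | ⟨i, j, hij, hi, hj⟩
  -- For an initial segment the two powers of q^γ are inverse to each other.
  · have hp : (∏ k ∈ S, qpow τ (-γ) ^ (k : ℕ)) * qpow τ γ ^ (∑ k ∈ Finset.range S.card, k) = 1 := by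
      have hle : S.card ≤ n := by simpa using S.card_le_univ
      have hmem : ∀ k : Fin n, k ∈ S ↔ (k : ℕ) < S.card := fun k => by
        conv_lhs => rw [hS]
        simp
      have hsum : ∑ k ∈ S, (k : ℕ) = ∑ k ∈ Finset.range S.card, k := by
        refine Finset.sum_nbij (fun k : Fin n => (k : ℕ)) ?_ ?_ ?_ (fun _ _ => rfl)
        · intro k hk
          simpa using (hmem k).mp hk
        · intro a _ b _ hab
          exact Fin.ext hab
        · intro k hk
          have hk' : k < S.card := by simpa using hk
          exact ⟨⟨k, by omega⟩, (hmem _).mpr hk', rfl⟩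
      rw [Finset.prod_pow_eq_pow_sum, hsum, qpow_neg, ← mul_pow,
        inv_mul_cancel₀ (qpow_ne_zero _ _), one_pow]
    rw [← mul_assoc, hp, one_mul, ← hS]
  · have hne : i ≠ j := by rintro rfl; omega
    have hie : i ∉ S.erase j := fun h => hi (Finset.mem_of_mem_erase h)
    have hcard : (insert i (S.erase j)).card = S.card := by
      rw [Finset.card_insert_of_notMem hie, Finset.card_erase_add_one hj]
    have hlt : ∑ k ∈ insert i (S.erase j), (k : ℕ) < N := by
      rw [Finset.sum_insert hie, ← hN, ← Finset.add_sum_erase S _ hj]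
      omega
    have h1 := ih _ hlt (insert i (S.erase j)) rfl
    rw [hcard, Finset.prod_insert hie] at h1
    have h2 := altMonomial_insert_succ τ γ hij hie (Finset.notMem_erase j S) t
    rw [Finset.insert_erase hj] at h2
    rw [h2, h1, ← Finset.mul_prod_erase S _ hj, hij, pow_succ]
    ring

/-- `𝒜 [∏_k (1 - a_k t_k) · ∏_{i < j} (t_i - q^{-γ} t_j)]`. -/
noncomputable def altLinear (τ γ : ℂ) (a : Fin n → ℂ) : (Fin n → ℂ) → ℂ :=
  altSum fun t => (∏ k, (1 - a k * t k)) * deltaGamma τ γ t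

lemma altLinear_eq_sum (τ γ : ℂ) (a : Fin n → ℂ) (t : Fin n → ℂ) :
    altLinear τ γ a t = ∑ S : Finset (Fin n), (∏ k ∈ S, -a k) * altMonomial τ γ S t := by
  unfold altLinear altMonomial
  simp only [← altSum_smul]
  rw [← altSum_sum]
  congr 1
  funext t
  simp only [sub_eq_add_neg, Finset.prod_one_add, Finset.sum_mul, Finset.powerset_univ]
  refine Finset.sum_congr rfl fun S _ => ?_
  rw [← mul_assoc, ← Finset.prod_mul_distrib]
  simp only [neg_mul]

/-- The polynomial `∏_k (1 - a_k q^{-kγ} w)`. -/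
noncomputable def shiftPoly (τ γ : ℂ) (a : Fin n → ℂ) : Polynomial ℂ :=
  ∏ k : Fin n, (1 + Polynomial.C (-a k * qpow τ (-γ) ^ (k : ℕ)) * Polynomial.X)

/-- `altLinear a` is a linear function of the polynomial `∏_k (1 - a_k q^{-kγ} w)`. -/
lemma altLinear_linear (τ γ : ℂ) (t : Fin n → ℂ) :
    ∃ Λ : Polynomial ℂ →ₗ[ℂ] ℂ, ∀ a : Fin n → ℂ, altLinear τ γ a t = Λ (shiftPoly τ γ a) := by
  -- The functional sends z^m to the normalised alternating sum of t_0 ⋯ t_{m-1} Δ. The coefficient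
  -- of z^m in `shiftPoly` collects exactly the weights of the sets S with |S| = m.
  refine ⟨(Polynomial.basisMonomials ℂ).constr ℂ fun m =>
    qpow τ γ ^ (∑ k ∈ Finset.range m, k) *
      altMonomial τ γ (Finset.univ.filter fun k : Fin n => (k : ℕ) < m) t, fun a => ?_⟩
  rw [altLinear_eq_sum, shiftPoly, Finset.prod_one_add, map_sum, Finset.powerset_univ]
  refine Finset.sum_congr rfl fun S _ => ?_
  have h : ∏ k ∈ S, Polynomial.C (-a k * qpow τ (-γ) ^ (k : ℕ)) * Polynomial.X =
      (∏ k ∈ S, -a k * qpow τ (-γ) ^ (k : ℕ)) • Polynomial.basisMonomials ℂ S.card := by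
    rw [Finset.prod_mul_distrib, Finset.prod_const, ← map_prod, Polynomial.coe_basisMonomials,
      Polynomial.smul_monomial, smul_eq_mul, mul_one, Polynomial.C_mul_X_pow_eq_monomial]
  rw [h, map_smul, Module.Basis.constr_basis, altMonomial_eq, smul_eq_mul, Finset.prod_mul_distrib]
  ring

/-- A permutation other than the identity reverses the order of the preimages of some `m`,
`m + 1`. -/
lemma exists_descent {σ : Equiv.Perm (Fin n)} (hσ : σ ≠ 1) :
    ∃ i j : Fin n, i < j ∧ (σ i : ℕ) = σ j + 1 := by
  by_contra! h
  apply hσ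
  -- If no consecutive values are reversed, σ⁻¹ is increasing, and the only order automorphism of
  -- `Fin n` is the identity.
  have hmono : StrictMono σ.symm := by
    rcases n with _ | n
    · intro a; exact a.elim0
    · rw [Fin.strictMono_iff_lt_succ]
      intro m
      rcases lt_trichotomy (σ.symm m.castSucc) (σ.symm m.succ) with h1 | h1 | h1
      · exact h1
      · exact absurd (σ.symm.injective h1) (Fin.castSucc_lt_succ).ne
      · exact absurd (by simp) (h _ _ h1)
  have := Subsingleton.elim (StrictMono.orderIsoOfSurjective _ hmono σ.symm.surjective)
    (OrderIso.refl (Fin n))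
  ext k
  have hk : σ.symm k = k := DFunLike.congr_fun this k
  rw [Equiv.symm_apply_eq] at hk
  rw [← hk]
  rfl

/-- At a geometric progression `t_k = z q^{-kγ}` only the identity permutation contributes. -/
lemma altLinear_geometric (τ γ z : ℂ) (a : Fin n → ℂ) :
    altLinear τ γ a (fun k => z * qpow τ (-γ) ^ (k : ℕ)) =
      (shiftPoly τ γ a).eval z *
        deltaGamma τ γ (fun k : Fin n => z * qpow τ (-γ) ^ (k : ℕ)) := by
  unfold altLinear altSum
  rw [Finset.sum_eq_single 1]
  · simp only [Equiv.Perm.sign_one, Equiv.Perm.one_apply, Units.val_one, Int.cast_one, one_mul,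
      shiftPoly, Polynomial.eval_prod]
    congr 1
    refine Finset.prod_congr rfl fun k _ => ?_
    simp
    ring
  · intro σ _ hσ
    -- For σ i = σ j + 1 the values satisfy t_{σ i} = q^{-γ} t_{σ j}, which kills the factor of the
    -- pair i < j.
    obtain ⟨i, j, hij, h⟩ := exists_descent hσ
    have : deltaGamma τ γ (fun k : Fin n => z * qpow τ (-γ) ^ (σ k : ℕ)) = 0 := by
      unfold deltaGamma
      refine Finset.prod_eq_zero (Finset.mem_univ i) (Finset.prod_eq_zero (Finset.mem_univ j) ?_)
      rw [if_pos hij]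
      simp only [h]
      ring
    simp only [this, mul_zero]
  · simp

/-- The factor of i < j is a nonzero multiple of q^{(j-i+1)γ} - 1, and 2 ≤ j - i + 1 ≤ n. -/
lemma deltaGamma_geometric_ne_zero (τ γ : ℂ) {z : ℂ} (hz : z ≠ 0)
    (hγ : ∀ k : ℕ, 1 ≤ k → k ≤ n → qpow τ γ ^ k ≠ 1) :
    deltaGamma τ γ (fun k : Fin n => z * qpow τ (-γ) ^ (k : ℕ)) ≠ 0 := by
  unfold deltaGamma
  refine Finset.prod_ne_zero_iff.mpr fun i _ => Finset.prod_ne_zero_iff.mpr fun j _ => ?_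
  split_ifs with hij
  · rw [Fin.lt_def] at hij
    obtain ⟨d, hd⟩ := Nat.exists_eq_add_of_lt hij
    have hq := qpow_ne_zero τ γ
    simp only [hd, qpow_neg]
    have h : z * (qpow τ γ)⁻¹ ^ (i : ℕ) -
        (qpow τ γ)⁻¹ * (z * (qpow τ γ)⁻¹ ^ ((i : ℕ) + d + 1)) =
        z * (qpow τ γ)⁻¹ ^ ((i : ℕ) + d + 2) * (qpow τ γ ^ (d + 2) - 1) := by
      simp only [inv_pow]
      field_simp
      ring
    rw [h]
    exact mul_ne_zero (mul_ne_zero hz (pow_ne_zero _ (inv_ne_zero hq)))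
      (sub_ne_zero.mpr (hγ _ (by omega) (by omega)))
  · exact one_ne_zero

end AlternatingSums

/-! ### Gaussian binomial coefficients and shifted factorials. -/

section GaussianBinomials

/-- The Gaussian binomial coefficients with base `c`. -/
def gaussBinom (c : ℂ) : ℕ → ℕ → ℂ
  | _, 0 => 1
  | 0, _ + 1 => 0
  | m + 1, k + 1 => gaussBinom c m (k + 1) * c ^ (k + 1) + gaussBinom c m k

lemma gaussBinom_zero_right (c : ℂ) (m : ℕ) : gaussBinom c m 0 = 1 := by
  cases m <;> rfl

lemma gaussBinom_succ_succ (c : ℂ) (m k : ℕ) :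
    gaussBinom c (m + 1) (k + 1) = gaussBinom c m (k + 1) * c ^ (k + 1) + gaussBinom c m k := rfl

lemma gaussBinom_eq_zero (c : ℂ) : ∀ {m k : ℕ}, m < k → gaussBinom c m k = 0
  | 0, k + 1, _ => rfl
  | m + 1, k + 1, h => by
    rw [gaussBinom_succ_succ, gaussBinom_eq_zero c (show m < k + 1 by omega),
      gaussBinom_eq_zero c (show m < k by omega)]
    ring

lemma gaussBinom_self (c : ℂ) (m : ℕ) : gaussBinom c m m = 1 := by
  induction m with
  | zero => rfl
  | succ m ih => rw [gaussBinom_succ_succ, gaussBinom_eq_zero c (Nat.lt_succ_self m), ih]; ring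

/-- The second Pascal rule. -/
lemma gaussBinom_succ_succ' (c : ℂ) : ∀ l k : ℕ,
    gaussBinom c (k + l + 1) (k + 1) =
      gaussBinom c (k + l) (k + 1) + c ^ l * gaussBinom c (k + l) k
  | 0, k => by
    simp [gaussBinom_self, gaussBinom_eq_zero c (Nat.lt_succ_self k)]
  | l + 1, 0 => by
    have h := gaussBinom_succ_succ' c l 0
    have h1 := gaussBinom_succ_succ c (0 + (l + 1)) 0
    have h2 := gaussBinom_succ_succ c (0 + l) 0
    simp only [gaussBinom_zero_right, zero_add, ← add_assoc] at h h1 h2 ⊢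
    rw [h1, h]
    linear_combination h - h2
  | l + 1, k + 1 => by
    have h1 := gaussBinom_succ_succ' c l (k + 1)
    have h2 := gaussBinom_succ_succ' c (l + 1) k
    have e1 := gaussBinom_succ_succ c (k + 1 + (l + 1)) (k + 1)
    have e2 := gaussBinom_succ_succ c (k + 1 + l) (k + 1)
    have e3 := gaussBinom_succ_succ c (k + 1 + l) k
    rw [show k + (l + 1) = k + 1 + l by ring] at h2
    rw [show k + 1 + (l + 1) = k + 1 + l + 1 by ring] at e1 ⊢
    linear_combination e1 + (c ^ (k + 2) - 1) * h1 + (h1 - e2) + (1 - c ^ (l + 1)) * h2 +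
      c ^ (l + 1) * (h2 - e3)

lemma poch_succ (a c : ℂ) (m : ℕ) : poch a c (m + 1) = poch a c m * (1 - a * c ^ m) :=
  Finset.prod_range_succ _ _

lemma poch_succ' (a c : ℂ) (m : ℕ) : poch a c (m + 1) = (1 - a) * poch (a * c) c m := by
  unfold poch
  rw [Finset.prod_range_succ', pow_zero, mul_one, mul_comm]
  congr 1
  exact Finset.prod_congr rfl fun i _ => by ring

lemma poch_zero (a c : ℂ) : poch a c 0 = 1 := Finset.prod_range_zero _

lemma poch_add (a c : ℂ) (m l : ℕ) :
    poch a c (m + l) = poch a c m * poch (a * c ^ m) c l := by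
  unfold poch
  rw [Finset.prod_range_add]
  congr 1
  exact Finset.prod_congr rfl fun i _ => by ring

/-- Cleared of denominators, the product formula holds for every c. The induction rests on 1 -
c^{k+l+2} = c^{k+1} (1 - c^{l+1}) + (1 - c^{k+1}). -/
lemma gaussBinom_mul_poch (c : ℂ) : ∀ k l : ℕ,
    gaussBinom c (k + l) k * (poch c c l * poch c c k) = poch c c (k + l)
  | 0, l => by simp [gaussBinom_zero_right, poch_zero]
  | k + 1, 0 => by simp [gaussBinom_self, poch_zero]
  | k + 1, l + 1 => by
    have h1 := gaussBinom_mul_poch c (k + 1) l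
    have h2 := gaussBinom_mul_poch c k (l + 1)
    rw [show k + 1 + (l + 1) = k + 1 + l + 1 by ring, gaussBinom_succ_succ, poch_succ c c (k + 1 + l)]
    rw [show k + (l + 1) = k + 1 + l by ring] at h2
    rw [poch_succ c c l] at h2 ⊢
    rw [poch_succ c c k] at h1 ⊢
    linear_combination (c ^ (k + 1) * (1 - c * c ^ l)) * h1 + (1 - c * c ^ k) * h2

lemma poch_self_ne_zero {c : ℂ} {m : ℕ} (h : ∀ k, 1 ≤ k → k ≤ m → c ^ k ≠ 1) :
    poch c c m ≠ 0 := by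
  refine Finset.prod_ne_zero_iff.mpr fun i hi => ?_
  rw [← pow_succ']
  exact sub_ne_zero.mpr (h (i + 1) (by omega) (by have := Finset.mem_range.mp hi; omega)).symm

lemma gaussBinom_eq_div {c : ℂ} {k l : ℕ} (h : ∀ j, 1 ≤ j → j ≤ k + l → c ^ j ≠ 1) :
    gaussBinom c (k + l) k = poch c c (k + l) / (poch c c l * poch c c k) := by
  rw [eq_div_iff (mul_ne_zero (poch_self_ne_zero fun j h1 h2 => h j h1 (by omega))
    (poch_self_ne_zero fun j h1 h2 => h j h1 (by omega))), gaussBinom_mul_poch]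

end GaussianBinomials

/-! ### Two connection formulas between products of shifted factorials. -/

section ConnectionFormulas

/-- A sum over `k ≤ m + 1` whose coefficients satisfy a Pascal rule. -/
lemma sum_range_succ_of_pascal (m : ℕ) (A α β C B : ℕ → ℂ)
    (h0 : C 0 = β 0 * A 0) (hm : C (m + 1) = α m * A m)
    (h : ∀ k < m, C (k + 1) = β (k + 1) * A (k + 1) + α k * A k) :
    ∑ k ∈ Finset.range (m + 2), C k * B k =
      ∑ k ∈ Finset.range (m + 1), A k * (α k * B (k + 1) + β k * B k) := by
  rw [Finset.sum_range_succ, Finset.sum_range_succ', h0, hm,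
    Finset.sum_congr rfl fun k hk => by rw [h k (Finset.mem_range.mp hk)]]
  simp only [mul_add, Finset.sum_add_distrib]
  rw [Finset.sum_range_succ (fun k => A k * (α k * B (k + 1))),
    Finset.sum_range_succ' (fun k => A k * (β k * B k))]
  simp only [add_mul, Finset.sum_add_distrib, mul_assoc, mul_comm (α _),
    mul_comm (β _)]
  abel

/-- The expansion of `(d w; c)_s` in the polynomials `(a c^r w; c)_{s - r} (b w; c)_r`. -/
lemma poch_expansion_left (c : ℂ) (b d w : ℂ) (s : ℕ) : ∀ a : ℂ,
    ∑ r ∈ Finset.range (s + 1), (gaussBinom c s r *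
        (∏ j ∈ Finset.range (s - r), (d * c ^ j - b)) * ∏ j ∈ Finset.range r, (a * c ^ j - d)) *
        (poch (a * c ^ r * w) c (s - r) * poch (b * w) c r) =
      (∏ j ∈ Finset.range s, (a * c ^ j - b)) * poch (d * w) c s := by
  induction s with
  | zero => intro a; simp [poch, gaussBinom_zero_right]
  | succ s ih =>
    intro a
    -- The case s for a c is multiplied by (a - b)(1 - d c^s w), which in the r-th term splits as (a
    -- - d c^{s-r})(1 - b c^r w) + (d c^{s-r} - b)(1 - a c^r w). The two parts extend one or the
    -- other shifted factorial.
    rw [sum_range_succ_of_pascal s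
      (fun r => gaussBinom c s r * (∏ j ∈ Finset.range (s - r), (d * c ^ j - b)) *
        ∏ j ∈ Finset.range r, (a * c * c ^ j - d))
      (fun r => a - d * c ^ (s - r)) (fun r => d * c ^ (s - r) - b)
      (fun r => gaussBinom c (s + 1) r *
        (∏ j ∈ Finset.range (s + 1 - r), (d * c ^ j - b)) *
        ∏ j ∈ Finset.range r, (a * c ^ j - d))
      (fun r => poch (a * c ^ r * w) c (s + 1 - r) * poch (b * w) c r)]
    · rw [Finset.prod_range_succ', poch_succ]
      have h := ih (a * c)
      have e : ∏ j ∈ Finset.range s, (a * c * c ^ j - b) =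
          ∏ j ∈ Finset.range s, (a * c ^ (j + 1) - b) :=
        Finset.prod_congr rfl fun j _ => by ring
      rw [e] at h
      rw [show ∀ x y z u : ℂ, x * y * (z * u) = (x * z) * (y * u) by intros; ring, ← h,
        Finset.sum_mul]
      refine Finset.sum_congr rfl fun r hr => ?_
      obtain ⟨l, rfl⟩ := Nat.exists_eq_add_of_le (Nat.lt_succ_iff.mp (Finset.mem_range.mp hr))
      rw [show r + l + 1 - (r + 1) = l by omega, show r + l - r = l by omega,
        show r + l + 1 - r = l + 1 by omega, poch_succ (b * w), poch_succ' _ _ l,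
        show a * c ^ (r + 1) * w = a * c ^ r * w * c by ring,
        show a * c * c ^ r * w = a * c ^ r * w * c by ring]
      ring
    · simp only [gaussBinom_zero_right, Nat.sub_zero, Finset.prod_range_zero,
        Finset.prod_range_succ]
      ring
    · have e : ∏ j ∈ Finset.range s, (a * c * c ^ j - d) =
          ∏ j ∈ Finset.range s, (a * c ^ (j + 1) - d) :=
        Finset.prod_congr rfl fun j _ => by ring
      simp only [gaussBinom_self, Nat.sub_self, Finset.prod_range_zero, pow_zero, e]
      rw [Finset.prod_range_succ']
      ring
    · intro k hk
      obtain ⟨l, rfl⟩ := Nat.exists_eq_add_of_lt hk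
      have e : ∏ j ∈ Finset.range k, (a * c * c ^ j - d) =
          ∏ j ∈ Finset.range k, (a * c ^ (j + 1) - d) :=
        Finset.prod_congr rfl fun j _ => by ring
      have p1 := gaussBinom_succ_succ c (k + l + 1) k
      have p2 := gaussBinom_succ_succ' c (l + 1) k
      rw [← add_assoc] at p2
      simp only [show k + l + 1 + 1 - (k + 1) = l + 1 by omega,
        show k + l + 1 - (k + 1) = l by omega, show k + l + 1 - k = l + 1 by omega]
      rw [Finset.prod_range_succ (fun j => a * c * c ^ j - d), e,
        Finset.prod_range_succ' (fun j => a * c ^ j - d), Finset.prod_range_succ _ l]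
      set Q := ∏ j ∈ Finset.range k, (a * c ^ (j + 1) - d)
      set D := ∏ j ∈ Finset.range l, (d * c ^ j - b)
      -- The Pascal rule for these coefficients is a times the first rule minus d times the second.
      linear_combination D * (d * c ^ l - b) * Q * (a * p1 - d * p2)

lemma prod_range_mul_sub_mul (c d e : ℂ) (m : ℕ) :
    ∏ j ∈ Finset.range m, (d * c - e * c * c ^ j) =
      c ^ m * ∏ j ∈ Finset.range m, (d - e * c ^ j) := by
  have h := Finset.pow_card_mul_prod (s := Finset.range m) (b := c) (f := fun j => d - e * c ^ j)
  rw [Finset.card_range] at h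
  rw [h]
  exact Finset.prod_congr rfl fun j _ => by ring

/-- The coefficients of the expansion of `(d w; c)_m` in the polynomials
`(f c^{-k} w; c)_k (e c^k w; c)_{m - k}`. -/
noncomputable def connCoeff (c d e f : ℂ) (m k : ℕ) : ℂ :=
  gaussBinom c m k * c ^ (k ^ 2) * (∏ j ∈ Finset.range (m - k), (f - d * c ^ (k + 1 + j))) *
    (∏ j ∈ Finset.range k, (d - e * c ^ j)) /
    ((∏ j ∈ Finset.range k, (f - e * c ^ (k + j))) *
      ∏ j ∈ Finset.range (m - k), (f - e * c ^ (2 * k + 1 + j)))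

/-- Induction on m, peeling 1 - d w off (d w; c)_{m+1} and passing to d c and e c. The exponents 1,
…, 2m - 1 excluded by the hypothesis cover all denominators of `connCoeff`, and the shift of e stays
within the range for m + 1. -/
lemma poch_expansion_right {c : ℂ} (hc : c ≠ 0) (f w : ℂ) (m : ℕ) : ∀ d e : ℂ,
    (∀ j, 1 ≤ j → j + 1 ≤ 2 * m → f - e * c ^ j ≠ 0) →
    ∑ k ∈ Finset.range (m + 1), connCoeff c d e f m k *
        (poch (f / c ^ k * w) c k * poch (e * c ^ k * w) c (m - k)) = poch (d * w) c m := by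
  induction m with
  | zero => intro d e _; simp [poch, connCoeff, gaussBinom_zero_right]
  | succ m ih =>
    intro d e he
    -- The weights α_k, β_k solve 1 - d w = α_k (1 - f c^{-k-1} w) + β_k (1 - e c^k w).
    rw [sum_range_succ_of_pascal m (connCoeff c (d * c) (e * c) f m)
      (fun k => c ^ (k + 1) * (d - e * c ^ k) / (f - e * c ^ (2 * k + 1)))
      (fun k => (f - d * c ^ (k + 1)) / (f - e * c ^ (2 * k + 1)))
      (connCoeff c d e f (m + 1))
      (fun k => poch (f / c ^ k * w) c k * poch (e * c ^ k * w) c (m + 1 - k))]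
    · have h := ih (d * c) (e * c) (by
        intro j h1 h2
        rw [mul_assoc, ← pow_succ']
        exact he (j + 1) (by omega) (by omega))
      rw [poch_succ', show d * w * c = d * c * w by ring, ← h, Finset.mul_sum]
      refine Finset.sum_congr rfl fun k hk => ?_
      obtain ⟨l, rfl⟩ := Nat.exists_eq_add_of_le (Nat.lt_succ_iff.mp (Finset.mem_range.mp hk))
      have hne := he (2 * k + 1) (by omega) (by omega)
      rw [show k + l + 1 - (k + 1) = l by omega, show k + l - k = l by omega,
        show k + l + 1 - k = l + 1 by omega, poch_succ' _ _ l, poch_succ' _ _ k,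
        show f / c ^ (k + 1) * w * c = f / c ^ k * w by rw [pow_succ]; field_simp,
        show e * c ^ k * w * c = e * c ^ (k + 1) * w by ring,
        show e * c * c ^ k * w = e * c ^ (k + 1) * w by ring]
      field_simp
      ring
    · have hne := he 1 le_rfl (by omega)
      simp only [connCoeff, gaussBinom_zero_right, Nat.sub_zero, Finset.prod_range_zero,
        mul_zero, zero_add, mul_one, one_mul, pow_one, ne_eq, OfNat.ofNat_ne_zero, not_false_eq_true,
        zero_pow, pow_zero]
      rw [Finset.prod_range_succ' _ m, Finset.prod_range_succ' _ m, div_mul_div_comm]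
      simp only [add_zero, pow_one, mul_assoc, ← pow_succ']
      simp only [add_comm, add_left_comm, mul_comm]
    · simp only [connCoeff, gaussBinom_self, Nat.sub_self, Finset.prod_range_zero]
      rw [Finset.prod_range_succ _ m, Finset.prod_range_succ (fun j => f - e * c ^ (m + 1 + j)) m,
        div_mul_div_comm, prod_range_mul_sub_mul]
      have e2 : ∏ j ∈ Finset.range m, (f - e * c * c ^ (m + j)) =
          ∏ j ∈ Finset.range m, (f - e * c ^ (m + 1 + j)) :=
        Finset.prod_congr rfl fun j _ => by ring
      rw [e2]
      congr 1 <;> ring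
    · intro k hk
      obtain ⟨l, rfl⟩ := Nat.exists_eq_add_of_lt hk
      have p1 := gaussBinom_succ_succ c (k + l + 1) k
      have p2 := gaussBinom_succ_succ' c (l + 1) k
      rw [← add_assoc] at p2
      have hprod : ∀ i p : ℕ, i + p ≤ 2 * (k + l + 2) → 1 ≤ i →
          ∏ j ∈ Finset.range p, (f - e * c ^ (i + j)) ≠ 0 := fun i p h1 h2 =>
        Finset.prod_ne_zero_iff.mpr fun j hj => by
          have := Finset.mem_range.mp hj
          exact he (i + j) (by omega) (by omega)
      have hx := he (2 * k + 2) (by omega) (by omega)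
      have hy := he (k + 1) (by omega) (by omega)
      have hz := he (2 * k + l + 3) (by omega) (by omega)
      have hT1 := hprod (k + 1) (k + 1) (by omega) (by omega)
      have hT2 := hprod (2 * k + 3) (l + 1) (by omega) (by omega)
      -- Both contributions are brought to one common prefactor and denominator, leaving only
      -- Gaussian binomials times linear factors.
      have hβ : (f - d * c ^ (k + 1 + 1)) / (f - e * c ^ (2 * (k + 1) + 1)) *
          connCoeff c (d * c) (e * c) f (k + l + 1) (k + 1) =
          c ^ ((k + 1) ^ 2) * (∏ j ∈ Finset.range (l + 1), (f - d * c ^ (k + 2 + j))) *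
            (∏ j ∈ Finset.range (k + 1), (d - e * c ^ j)) *
            (gaussBinom c (k + l + 1) (k + 1) * c ^ (k + 1) * (f - e * c ^ (k + 1))) /
          ((∏ j ∈ Finset.range (k + 1), (f - e * c ^ (k + 1 + j))) *
            (∏ j ∈ Finset.range (l + 1), (f - e * c ^ (2 * k + 3 + j))) *
            (f - e * c ^ (2 * k + 2))) := by
        have hN : ∏ j ∈ Finset.range (l + 1), (f - d * c ^ (k + 2 + j)) =
            (∏ j ∈ Finset.range l, (f - d * c * c ^ (k + 1 + 1 + j))) *
              (f - d * c ^ (k + 1 + 1)) := by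
          rw [Finset.prod_range_succ', add_zero]
          congr 1
          exact Finset.prod_congr rfl fun j _ => by ring
        have hA : ∏ j ∈ Finset.range (k + 1), (f - e * c ^ (k + 1 + j)) =
            (∏ j ∈ Finset.range k, (f - e * c ^ (k + 2 + j))) * (f - e * c ^ (k + 1)) := by
          rw [Finset.prod_range_succ', add_zero]
          congr 1
          exact Finset.prod_congr rfl fun j _ => by ring
        have hB : ∏ j ∈ Finset.range (k + 1), (f - e * c * c ^ (k + 1 + j)) =
            (∏ j ∈ Finset.range k, (f - e * c ^ (k + 2 + j))) * (f - e * c ^ (2 * k + 2)) := by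
          rw [Finset.prod_range_succ]
          congr 1
          · exact Finset.prod_congr rfl fun j _ => by ring
          · ring
        have hC : ∏ j ∈ Finset.range (l + 1), (f - e * c ^ (2 * k + 3 + j)) =
            (∏ j ∈ Finset.range l, (f - e * c * c ^ (2 * (k + 1) + 1 + j))) *
              (f - e * c ^ (2 * (k + 1) + 1)) := by
          rw [Finset.prod_range_succ']
          congr 1
          · exact Finset.prod_congr rfl fun j _ => by ring
        rw [hA] at hT1
        rw [hC] at hT2
        have h1 := left_ne_zero_of_mul hT1
        have h2 := left_ne_zero_of_mul hT2
        have h3 := right_ne_zero_of_mul hT2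
        rw [connCoeff, show k + l + 1 - (k + 1) = l by omega, prod_range_mul_sub_mul, hN, hA, hB, hC]
        generalize ∏ j ∈ Finset.range k, (f - e * c ^ (k + 2 + j)) = A at *
        generalize ∏ j ∈ Finset.range l, (f - e * c * c ^ (2 * (k + 1) + 1 + j)) = B at *
        field_simp
      have hα : c ^ (k + 1) * (d - e * c ^ k) / (f - e * c ^ (2 * k + 1)) *
          connCoeff c (d * c) (e * c) f (k + l + 1) k =
          c ^ ((k + 1) ^ 2) * (∏ j ∈ Finset.range (l + 1), (f - d * c ^ (k + 2 + j))) *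
            (∏ j ∈ Finset.range (k + 1), (d - e * c ^ j)) *
            (gaussBinom c (k + l + 1) k * (f - e * c ^ (2 * k + l + 3))) /
          ((∏ j ∈ Finset.range (k + 1), (f - e * c ^ (k + 1 + j))) *
            (∏ j ∈ Finset.range (l + 1), (f - e * c ^ (2 * k + 3 + j))) *
            (f - e * c ^ (2 * k + 2))) := by
        have hN : ∏ j ∈ Finset.range (l + 1), (f - d * c ^ (k + 2 + j)) =
            ∏ j ∈ Finset.range (l + 1), (f - d * c * c ^ (k + 1 + j)) :=
          Finset.prod_congr rfl fun j _ => by ring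
        have hA : ∏ j ∈ Finset.range (k + 1), (f - e * c ^ (k + 1 + j)) =
            (∏ j ∈ Finset.range k, (f - e * c * c ^ (k + j))) * (f - e * c ^ (2 * k + 1)) := by
          rw [Finset.prod_range_succ]
          congr 1
          · exact Finset.prod_congr rfl fun j _ => by ring
          · ring
        have hB : ∏ j ∈ Finset.range (l + 1), (f - e * c * c ^ (2 * k + 1 + j)) =
            (∏ j ∈ Finset.range l, (f - e * c ^ (2 * k + 3 + j))) * (f - e * c ^ (2 * k + 2)) := by
          rw [Finset.prod_range_succ']
          congr 1
          · exact Finset.prod_congr rfl fun j _ => by ring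
          · ring
        have hC : ∏ j ∈ Finset.range (l + 1), (f - e * c ^ (2 * k + 3 + j)) =
            (∏ j ∈ Finset.range l, (f - e * c ^ (2 * k + 3 + j))) *
              (f - e * c ^ (2 * k + l + 3)) := by
          rw [Finset.prod_range_succ, show 2 * k + 3 + l = 2 * k + l + 3 by ring]
        rw [hA] at hT1
        rw [hC] at hT2
        have h1 := left_ne_zero_of_mul hT1
        have h2 := left_ne_zero_of_mul hT2
        have h3 := right_ne_zero_of_mul hT1
        rw [connCoeff, show k + l + 1 - k = l + 1 by omega, prod_range_mul_sub_mul, hN, hA, hB, hC,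
          Finset.prod_range_succ _ k]
        generalize ∏ j ∈ Finset.range k, (f - e * c * c ^ (k + j)) = A at *
        generalize ∏ j ∈ Finset.range l, (f - e * c ^ (2 * k + 3 + j)) = B at *
        field_simp
        ring
      rw [hβ, hα, ← add_div, eq_div_iff (mul_ne_zero (mul_ne_zero hT1 hT2) hx)]
      simp only [connCoeff, show k + l + 1 + 1 - (k + 1) = l + 1 by omega,
        show k + 1 + 1 = k + 2 by omega, show 2 * (k + 1) + 1 = 2 * k + 3 by omega]
      field_simp
      -- What remains is f times the first Pascal rule minus e c^{2k+2} times the second.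
      linear_combination (∏ j ∈ Finset.range (l + 1), (f - d * c ^ (k + 2 + j))) *
        (∏ j ∈ Finset.range (k + 1), (d - e * c ^ j)) * (f * p1 - e * c ^ (2 * k + 2) * p2)

end ConnectionFormulas

/-! ### The Gauss factors as connection coefficients. -/

section GaussFactors

/-- Reading the product backwards turns the shifted factorials in the denominators of U and D into
products over increasing powers of c. -/
lemma poch_div_pow {c : ℂ} (hc : c ≠ 0) (y : ℂ) (r m : ℕ) :
    poch (y * c / c ^ (r + m)) c m = ∏ j ∈ Finset.range m, (1 - y / c ^ (r + j)) := by
  rw [← Finset.prod_range_reflect]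
  refine Finset.prod_congr rfl fun j hj => ?_
  obtain ⟨l, rfl⟩ := Nat.exists_eq_add_of_lt (Finset.mem_range.mp hj)
  rw [show j + l + 1 - 1 - j = l by omega]
  congr 1
  field_simp
  ring

lemma prod_range_const_mul (b : ℂ) (f : ℕ → ℂ) (m : ℕ) :
    ∏ j ∈ Finset.range m, b * f j = b ^ m * ∏ j ∈ Finset.range m, f j := by
  rw [Finset.prod_mul_distrib, Finset.prod_const, Finset.card_range]

/-- The exponent is the arithmetic sum r + (r + 1) + ⋯ + (r + m - 1). -/
lemma qpow_triangular (τ γ : ℂ) (r m : ℕ) :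
    qpow τ (-((((r + m : ℕ) : ℂ) - r) * (((r + m : ℕ) : ℂ) + r - 1) * γ / 2)) =
      (∏ j ∈ Finset.range m, qpow τ γ ^ (r + j))⁻¹ := by
  rw [qpow_neg]
  congr 1
  induction m with
  | zero => simp [qpow]
  | succ m ih =>
    rw [Finset.prod_range_succ, ← ih, ← qpow_natCast_mul, ← qpow_add]
    congr 1
    push_cast
    ring

variable (τ γ β₁ β₂ X : ℂ)

lemma gaussU_apply_of_lt {n : ℕ} {i j : Fin (n + 1)} (h : j < i) :
    gaussU τ γ β₁ β₂ X n i j = 0 := by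
  simp only [gaussU, Matrix.of_apply]
  exact if_neg (not_le.mpr (Fin.lt_def.mp h))

lemma gaussL_apply_of_lt {n : ℕ} {i j : Fin (n + 1)} (h : i < j) :
    gaussL τ γ β₁ β₂ X n i j = 0 := by
  simp only [gaussL, Matrix.of_apply]
  exact if_neg (not_le.mpr (Fin.lt_def.mp h))

lemma gaussU_eq {n r m p : ℕ} (hn : n = r + m + p)
    (hγ : ∀ k : ℕ, 1 ≤ k → k ≤ n → qpow τ γ ^ k ≠ 1)
    {i j : Fin (n + 1)} (hi : (i : ℕ) = r) (hj : (j : ℕ) = r + m) :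
    gaussU τ γ β₁ β₂ X n i j = gaussBinom (qpow τ γ) (r + m) r *
      ((∏ j ∈ Finset.range m, (qpow τ β₁ * X * qpow τ γ ^ p * qpow τ γ ^ j - X)) /
        ∏ j ∈ Finset.range m,
          (qpow τ β₂ * qpow τ γ ^ (r + j) - qpow τ β₁ * X * qpow τ γ ^ p)) := by
  have hc := qpow_ne_zero τ γ
  have hB := qpow_ne_zero τ β₂
  have hu : qpow τ (β₁ + ((n : ℂ) - (r + m : ℕ)) * γ) = qpow τ β₁ * qpow τ γ ^ p := by
    rw [qpow_add, ← qpow_natCast_mul]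
    congr 2
    rw [hn]
    push_cast
    ring
  have hv : X * qpow τ (β₁ - β₂ + ((n : ℂ) - 2 * (r + m : ℕ) + 1) * γ) =
      qpow τ β₁ * X * qpow τ γ ^ p / qpow τ β₂ * qpow τ γ / qpow τ γ ^ (r + m) := by
    rw [← qpow_natCast_mul, ← qpow_natCast_mul, hn,
      show (β₁ - β₂ + (((r + m + p : ℕ) : ℂ) - 2 * (r + m : ℕ) + 1) * γ) =
        β₁ + p * γ - β₂ + γ - (r + m : ℕ) * γ by push_cast; ring,
      qpow_sub, qpow_add, qpow_sub, qpow_add]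
    ring
  simp only [gaussU, Matrix.of_apply, hi, hj]
  rw [if_pos (Nat.le_add_right r m), Nat.add_sub_cancel_left, qpow_triangular, hu, hv,
    poch_div_pow hc, gaussBinom_eq_div fun j h1 h2 => hγ j h1 (by omega), qpow_neg]
  have e1 : ∏ j ∈ Finset.range m, (qpow τ β₁ * X * qpow τ γ ^ p * qpow τ γ ^ j - X) =
      (-X) ^ m * poch (qpow τ β₁ * qpow τ γ ^ p) (qpow τ γ) m := by
    rw [poch, ← prod_range_const_mul]
    exact Finset.prod_congr rfl fun j _ => by ring
  have e2 : ∏ j ∈ Finset.range m,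
      (qpow τ β₂ * qpow τ γ ^ (r + j) - qpow τ β₁ * X * qpow τ γ ^ p) =
      qpow τ β₂ ^ m * ((∏ j ∈ Finset.range m, qpow τ γ ^ (r + j)) * ∏ j ∈ Finset.range m,
        (1 - qpow τ β₁ * X * qpow τ γ ^ p / qpow τ β₂ / qpow τ γ ^ (r + j))) := by
    rw [← Finset.prod_mul_distrib, ← prod_range_const_mul]
    exact Finset.prod_congr rfl fun j _ => by field_simp
  rw [e1, e2, mul_pow, neg_pow, inv_pow]
  simp only [div_eq_mul_inv, mul_inv]
  ring

/-- With d = 1, e = q^{β₁} X, f = q^{β₂} c^n and k = n - r, this is the part of `connCoeff` that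
depends on the column s. -/
lemma gaussL_eq {n s l k : ℕ} (hn : n = s + l + k)
    (hγ : ∀ k : ℕ, 1 ≤ k → k ≤ n → qpow τ γ ^ k ≠ 1)
    {i j : Fin (n + 1)} (hi : (i : ℕ) = s + l) (hj : (j : ℕ) = s) :
    gaussL τ γ β₁ β₂ X n i j = gaussBinom (qpow τ γ) (k + l) k *
      ((∏ j ∈ Finset.range l, (qpow τ β₂ * qpow τ γ ^ n - qpow τ γ ^ (k + 1 + j))) /
        ∏ j ∈ Finset.range l,
          (qpow τ β₂ * qpow τ γ ^ n - qpow τ β₁ * X * qpow τ γ ^ (2 * k + 1 + j))) := by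
  have hc := qpow_ne_zero τ γ
  have hB := qpow_ne_zero τ β₂
  have hu : qpow τ (β₂ + (s : ℂ) * γ) = qpow τ β₂ * qpow τ γ ^ s := by
    rw [qpow_add, ← qpow_natCast_mul]
  have hv : X * qpow τ (β₁ - β₂ + ((n : ℂ) - 2 * (s + l : ℕ) + 1) * γ) =
      qpow τ β₁ * X * qpow τ γ ^ (k + 1) / (qpow τ β₂ * qpow τ γ ^ (s + l)) := by
    rw [← qpow_natCast_mul, ← qpow_natCast_mul, hn,
      show (β₁ - β₂ + (((s + l + k : ℕ) : ℂ) - 2 * (s + l : ℕ) + 1) * γ) =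
        β₁ + (k + 1 : ℕ) * γ - (β₂ + (s + l : ℕ) * γ) by push_cast; ring,
      qpow_sub, qpow_add, qpow_add]
    ring
  have hw : qpow τ (β₂ * ((s : ℂ) - (s + l : ℕ))) = (qpow τ β₂ ^ l)⁻¹ := by
    rw [← qpow_natCast_mul, ← qpow_neg]
    congr 1
    push_cast
    ring
  have ht := qpow_triangular τ γ s l
  rw [show (((s + l : ℕ) : ℂ) + s - 1) = ((s + l : ℕ) : ℂ) + (s : ℕ) - 1 by rfl] at ht
  simp only [gaussL, Matrix.of_apply, hi, hj]
  rw [if_pos (Nat.le_add_right s l), Nat.add_sub_cancel_left, ht, hu, hv, hw,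
    gaussBinom_eq_div fun j h1 h2 => hγ j h1 (by omega),
    show n - s = k + l by omega, show n - (s + l) = k by omega]
  have e1 : (∏ j ∈ Finset.range l, (qpow τ β₂ * qpow τ γ ^ n - qpow τ γ ^ (k + 1 + j))) *
      ∏ j ∈ Finset.range l, qpow τ γ ^ (s + j) =
      (-1) ^ l * (qpow τ γ ^ n) ^ l * poch (qpow τ β₂ * qpow τ γ ^ s) (qpow τ γ) l := by
    rw [← Finset.prod_range_reflect (fun j => _ - qpow τ γ ^ (k + 1 + j)),
      ← Finset.prod_mul_distrib, poch, ← mul_pow, ← prod_range_const_mul]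
    refine Finset.prod_congr rfl fun j hj => ?_
    obtain ⟨a, rfl⟩ := Nat.exists_eq_add_of_lt (Finset.mem_range.mp hj)
    rw [show j + a + 1 - 1 - j = a by omega, hn]
    ring
  have e2 : ∏ j ∈ Finset.range l,
      (qpow τ β₂ * qpow τ γ ^ n - qpow τ β₁ * X * qpow τ γ ^ (2 * k + 1 + j)) =
      (qpow τ β₂ * qpow τ γ ^ n) ^ l *
        poch (qpow τ β₁ * X * qpow τ γ ^ (k + 1) / (qpow τ β₂ * qpow τ γ ^ (s + l)))
          (qpow τ γ) l := by
    rw [poch, ← prod_range_const_mul]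
    refine Finset.prod_congr rfl fun j _ => ?_
    rw [hn]
    field_simp
    ring
  have hp : ∏ j ∈ Finset.range l, qpow τ γ ^ (s + j) ≠ 0 :=
    Finset.prod_ne_zero_iff.mpr fun j _ => pow_ne_zero _ hc
  rw [eq_div_of_mul_eq hp e1, e2, mul_pow]
  have hcn : (qpow τ γ ^ n) ^ l ≠ 0 := pow_ne_zero _ (pow_ne_zero _ hc)
  generalize (qpow τ γ ^ n) ^ l = N at *
  simp only [div_eq_mul_inv, mul_inv]
  field_simp

/-- The proportionality factor between `Σ_r φ_r u_{rs}` and the intermediate basis. -/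
noncomputable def gaussNormalization (n s : ℕ) : ℂ :=
  (∏ j ∈ Finset.range s, (qpow τ β₂ * qpow τ γ ^ j - X)) /
    ∏ j ∈ Finset.range s,
      (qpow τ β₂ * qpow τ γ ^ j - qpow τ β₁ * X * qpow τ γ ^ (n - s))

/-- The remaining part of `connCoeff`, which depends only on n and k = n - r: the entry d_r undoes
the normalisation and supplies it. -/
lemma gaussNormalization_mul_gaussDEntry {n r k : ℕ} (hn : n = r + k)
    (hX : ∀ j < n, qpow τ β₂ * qpow τ γ ^ j - X ≠ 0)
    (hd : ∀ j < r, qpow τ β₂ * qpow τ γ ^ j - qpow τ β₁ * X * qpow τ γ ^ k ≠ 0) :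
    gaussNormalization τ γ β₁ β₂ X n r * gaussDEntry τ γ β₁ β₂ X n r =
      (qpow τ γ ^ (k ^ 2) * ∏ j ∈ Finset.range k, (1 - qpow τ β₁ * X * qpow τ γ ^ j)) /
        ∏ j ∈ Finset.range k,
          (qpow τ β₂ * qpow τ γ ^ n - qpow τ β₁ * X * qpow τ γ ^ (k + j)) := by
  have hc := qpow_ne_zero τ γ
  have hB := qpow_ne_zero τ β₂
  have h1 : qpow τ (-(((n : ℂ) - r) * β₂) - (r : ℂ) * ((n : ℂ) - r) * γ) =
      ((qpow τ β₂ * qpow τ γ ^ r) ^ k)⁻¹ := by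
    rw [← qpow_natCast_mul, ← qpow_add, ← qpow_natCast_mul, ← qpow_neg, hn]
    congr 1
    push_cast
    ring
  have h2 : X * qpow τ (-β₂ - ((r : ℂ) - 1) * γ) =
      X / qpow τ β₂ * qpow τ γ / qpow τ γ ^ (0 + r) := by
    rw [zero_add, ← qpow_natCast_mul,
      show -β₂ - ((r : ℂ) - 1) * γ = -β₂ + γ - r * γ by ring, qpow_sub, qpow_add, qpow_neg]
    ring
  have h3 : X * qpow τ (β₁ - β₂ + ((n : ℂ) - 2 * r + 1) * γ) =
      qpow τ β₁ * X * qpow τ γ ^ k / qpow τ β₂ * qpow τ γ / qpow τ γ ^ (0 + r) := by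
    rw [zero_add, ← qpow_natCast_mul, ← qpow_natCast_mul, hn,
      show (β₁ - β₂ + (((r + k : ℕ) : ℂ) - 2 * r + 1) * γ) =
        β₁ + k * γ - β₂ + γ - r * γ by push_cast; ring,
      qpow_sub, qpow_add, qpow_sub, qpow_add]
    ring
  have h4 : X * qpow τ (β₁ - β₂ - (r : ℂ) * γ) =
      qpow τ β₁ * X / (qpow τ β₂ * qpow τ γ ^ r) := by
    rw [← qpow_natCast_mul, sub_sub, qpow_sub, qpow_add]
    ring
  have e1 : ∏ j ∈ Finset.range k,
      (qpow τ β₂ * qpow τ γ ^ n - qpow τ β₁ * X * qpow τ γ ^ (k + j)) =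
      (qpow τ γ ^ k * (qpow τ β₂ * qpow τ γ ^ r)) ^ k *
        poch (qpow τ β₁ * X / (qpow τ β₂ * qpow τ γ ^ r)) (qpow τ γ) k := by
    rw [poch, ← prod_range_const_mul]
    refine Finset.prod_congr rfl fun j _ => ?_
    rw [hn]
    field_simp
    ring
  have e2 : ∀ y : ℂ, ∏ j ∈ Finset.range r, (qpow τ β₂ * qpow τ γ ^ j - y) =
      (∏ j ∈ Finset.range r, qpow τ β₂ * qpow τ γ ^ j) *
        ∏ j ∈ Finset.range r, (1 - y / qpow τ β₂ / qpow τ γ ^ (0 + j)) := by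
    intro y
    rw [← Finset.prod_mul_distrib]
    refine Finset.prod_congr rfl fun j _ => ?_
    rw [zero_add]
    field_simp
  have n1 : ∏ j ∈ Finset.range r, (qpow τ β₂ * qpow τ γ ^ j - X) ≠ 0 :=
    Finset.prod_ne_zero_iff.mpr fun j hj => hX j (by have := Finset.mem_range.mp hj; omega)
  have n2 : ∏ j ∈ Finset.range r,
      (qpow τ β₂ * qpow τ γ ^ j - qpow τ β₁ * X * qpow τ γ ^ k) ≠ 0 :=
    Finset.prod_ne_zero_iff.mpr fun j hj => hd j (Finset.mem_range.mp hj)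
  rw [gaussNormalization, gaussDEntry, show n - r = k by omega, h1, h2, h3, h4, e1,
    poch_div_pow hc, poch_div_pow hc, show X * qpow τ β₁ = qpow τ β₁ * X by ring]
  rw [e2] at n1 n2 ⊢
  rw [e2, ← poch]
  have n1a := left_ne_zero_of_mul n1
  have n1b := right_ne_zero_of_mul n1
  have n2b := right_ne_zero_of_mul n2
  generalize ∏ j ∈ Finset.range r, (1 - X / qpow τ β₂ / qpow τ γ ^ (0 + j)) = u at *
  generalize ∏ j ∈ Finset.range r,
    (1 - qpow τ β₁ * X * qpow τ γ ^ k / qpow τ β₂ / qpow τ γ ^ (0 + j)) = v at *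
  generalize ∏ j ∈ Finset.range r, qpow τ β₂ * qpow τ γ ^ j = y at *
  rw [mul_pow (qpow τ γ ^ k), ← pow_mul, ← pow_two]
  generalize (qpow τ β₂ * qpow τ γ ^ r) ^ k = N
  have hk : qpow τ γ ^ k ^ 2 ≠ 0 := pow_ne_zero _ hc
  simp only [div_eq_mul_inv, mul_inv]
  field_simp

lemma sum_fin_eq_sum_range_le {n s : ℕ} (hs : s ≤ n) (g : Fin (n + 1) → ℂ) (h : ℕ → ℂ)
    (h1 : ∀ r : Fin (n + 1), (r : ℕ) ≤ s → g r = h r)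
    (h2 : ∀ r : Fin (n + 1), s < (r : ℕ) → g r = 0) :
    ∑ r, g r = ∑ r ∈ Finset.range (s + 1), h r := by
  have h3 : ∀ r : Fin (n + 1), g r = if (r : ℕ) ∈ Finset.range (s + 1) then h r else 0 := by
    intro r
    split_ifs with hr
    · exact h1 r (Nat.lt_succ_iff.mp (Finset.mem_range.mp hr))
    · exact h2 r (by simpa [Nat.lt_succ_iff] using hr)
  rw [Finset.sum_congr rfl fun r _ => h3 r,
    Fin.sum_univ_eq_sum_range (fun r => if r ∈ Finset.range (s + 1) then h r else 0),
    ← Finset.sum_filter]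
  refine Finset.sum_congr ?_ fun _ _ => rfl
  ext r
  simp only [Finset.mem_filter, Finset.mem_range]
  omega

variable {τ γ β₁ β₂ X}

lemma sum_mul_gaussU {n s : ℕ} (hs : s ≤ n)
    (hγ : ∀ k : ℕ, 1 ≤ k → k ≤ n → qpow τ γ ^ k ≠ 1)
    (hd : ∀ j < s, qpow τ β₂ * qpow τ γ ^ j - qpow τ β₁ * X * qpow τ γ ^ (n - s) ≠ 0)
    {j : Fin (n + 1)} (hj : (j : ℕ) = s) (w : ℂ) :
    ∑ r : Fin (n + 1), poch (qpow τ β₂ * qpow τ γ ^ (r : ℕ) * w) (qpow τ γ) (n - r) *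
        poch (X * w) (qpow τ γ) r * gaussU τ γ β₁ β₂ X n r j =
      gaussNormalization τ γ β₁ β₂ X n s *
        (poch (qpow τ β₂ * qpow τ γ ^ s * w) (qpow τ γ) (n - s) *
          poch (qpow τ β₁ * X * qpow τ γ ^ (n - s) * w) (qpow τ γ) s) := by
  have n0 : ∏ j ∈ Finset.range s,
      (qpow τ β₂ * qpow τ γ ^ j - qpow τ β₁ * X * qpow τ γ ^ (n - s)) ≠ 0 :=
    Finset.prod_ne_zero_iff.mpr fun j hj => hd j (Finset.mem_range.mp hj)
  have h := poch_expansion_left (qpow τ γ) X (qpow τ β₁ * X * qpow τ γ ^ (n - s)) w s (qpow τ β₂)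
  rw [gaussNormalization, div_mul_eq_mul_div, eq_div_iff n0, mul_left_comm, ← h, Finset.mul_sum,
    Finset.sum_mul]
  refine sum_fin_eq_sum_range_le hs _ _ (fun r hr => ?_) fun r hr => ?_
  · obtain ⟨m, rfl⟩ := Nat.exists_eq_add_of_le hr
    -- All terms r ≤ s share the factor (q^{β₂} c^s w; c)_{n-s}; what is left is
    -- `poch_expansion_left`.
    have hsplit : poch (qpow τ β₂ * qpow τ γ ^ (r : ℕ) * w) (qpow τ γ) (n - r) =
        poch (qpow τ β₂ * qpow τ γ ^ (r : ℕ) * w) (qpow τ γ) m *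
          poch (qpow τ β₂ * qpow τ γ ^ ((r : ℕ) + m) * w) (qpow τ γ) (n - (r + m)) := by
      rw [show n - (r : ℕ) = m + (n - (r + m)) by omega, poch_add]
      congr 2
      ring
    rw [gaussU_eq τ γ β₁ β₂ X (p := n - (r + m)) (by omega) hγ rfl hj, hsplit,
      Nat.add_sub_cancel_left]
    rw [Finset.prod_range_add] at n0 ⊢
    have n1 := right_ne_zero_of_mul n0
    generalize ∏ x ∈ Finset.range m, (qpow τ β₂ * qpow τ γ ^ ((r : ℕ) + x) - _) = D at *
    field_simp
  · rw [gaussU_apply_of_lt τ γ β₁ β₂ X (Fin.lt_def.mpr (hj ▸ hr)), mul_zero, zero_mul]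

lemma sum_mul_gaussL {n s : ℕ} (hs : s ≤ n)
    (hγ : ∀ k : ℕ, 1 ≤ k → k ≤ n → qpow τ γ ^ k ≠ 1)
    (hX : ∀ j < n, qpow τ β₂ * qpow τ γ ^ j - X ≠ 0)
    (hd : ∀ j k, j < n - k → k ≤ n →
      qpow τ β₂ * qpow τ γ ^ j - qpow τ β₁ * X * qpow τ γ ^ k ≠ 0)
    (he : ∀ j, 1 ≤ j → j + 1 ≤ 2 * n →
      qpow τ β₂ * qpow τ γ ^ n - qpow τ β₁ * X * qpow τ γ ^ j ≠ 0)
    {j : Fin (n + 1)} (hj : (j : ℕ) = s) (w : ℂ) :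
    ∑ r : Fin (n + 1), gaussNormalization τ γ β₁ β₂ X n r *
        (poch (qpow τ β₂ * qpow τ γ ^ (r : ℕ) * w) (qpow τ γ) (n - r) *
          poch (qpow τ β₁ * X * qpow τ γ ^ (n - (r : ℕ)) * w) (qpow τ γ) r) *
        gaussDEntry τ γ β₁ β₂ X n r * gaussL τ γ β₁ β₂ X n r j =
      poch (qpow τ β₁ * X * qpow τ γ ^ (n - s) * w) (qpow τ γ) s * poch w (qpow τ γ) (n - s) := by
  have hc := qpow_ne_zero τ γ
  have h := poch_expansion_right hc (qpow τ β₂ * qpow τ γ ^ n) w (n - s) 1 (qpow τ β₁ * X)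
    fun j h1 h2 => he j h1 (by omega)
  rw [one_mul] at h
  -- The k-th term of the expansion belongs to row r = n - k.
  rw [← h, Finset.mul_sum, ← Equiv.sum_comp Fin.revPerm]
  refine sum_fin_eq_sum_range_le (Nat.sub_le n s) _ _ (fun k hk => ?_) fun k hk => ?_
  · obtain ⟨l, hl⟩ := Nat.exists_eq_add_of_le hk
    have hr : ((Fin.revPerm k : Fin (n + 1)) : ℕ) = s + l := by
      rw [Fin.revPerm_apply, Fin.val_rev]
      omega
    have hsplit : poch (qpow τ β₁ * X * qpow τ γ ^ (k : ℕ) * w) (qpow τ γ) (s + l) =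
        poch (qpow τ β₁ * X * qpow τ γ ^ (k : ℕ) * w) (qpow τ γ) l *
          poch (qpow τ β₁ * X * qpow τ γ ^ (n - s) * w) (qpow τ γ) s := by
      rw [add_comm s l, poch_add, hl]
      congr 2
      ring
    have hDK := gaussNormalization_mul_gaussDEntry τ γ β₁ β₂ X (n := n) (r := s + l) (k := k)
      (by omega) hX fun j hj => hd j k (by omega) (by omega)
    have hf : qpow τ β₂ * qpow τ γ ^ n / qpow τ γ ^ (k : ℕ) = qpow τ β₂ * qpow τ γ ^ (s + l) := by
      rw [div_eq_iff (pow_ne_zero _ hc), mul_assoc, ← pow_add]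
      congr 2
      omega
    rw [gaussL_eq τ γ β₁ β₂ X (s := s) (l := l) (k := k) (by omega) hγ hr hj, hr,
      show n - (s + l) = k by omega, hsplit, hf, connCoeff, show n - s - k = l by omega,
      show n - s = k + l by omega]
    rw [show ∀ a b d e : ℂ, a * b * d * e = a * d * (b * e) by intros; ring, hDK]
    simp only [div_eq_mul_inv, mul_inv, one_mul]
    ring
  · have hr : ((Fin.revPerm k : Fin (n + 1)) : ℕ) < s := by
      rw [Fin.revPerm_apply, Fin.val_rev]
      have := k.isLt
      omega
    rw [gaussL_apply_of_lt τ γ β₁ β₂ X (Fin.lt_def.mpr (hj ▸ hr)), mul_zero]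

end GaussFactors

/-! ### Transition between the numerators, and independence of the φ_r. -/

section TransitionMatrix

/-- The coefficients `a_k` of the linear factors `1 - a_k t_k` of `matsuoNum`. -/
noncomputable def matsuoCoeff (a b : ℂ) {n : ℕ} (s : ℕ) (k : Fin n) : ℂ :=
  if (k : ℕ) < n - s then a else b

lemma matsuoNum_eq_altLinear (τ γ x₁ x₂ β₁ : ℂ) {n : ℕ} (s : ℕ) (t : Fin n → ℂ) :
    matsuoNum τ γ x₁ x₂ β₁ s t = altLinear τ γ (matsuoCoeff (qpow τ β₁ / x₁) (1 / x₂) s) t := by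
  unfold matsuoNum altLinear
  congr 1
  funext t
  congr 1
  refine Finset.prod_congr rfl fun k _ => ?_
  unfold matsuoCoeff
  split_ifs <;> ring

/-- The polynomial attached to `matsuoNum`, as a product of two shifted factorials. -/
lemma shiftPoly_matsuoCoeff_eval (τ γ a b : ℂ) {n s : ℕ} (hs : s ≤ n) (w : ℂ) :
    (shiftPoly τ γ (n := n) (matsuoCoeff a b s)).eval (w * qpow τ γ ^ (n - 1)) =
      poch (a * qpow τ γ ^ s * w) (qpow τ γ) (n - s) * poch (b * w) (qpow τ γ) s := by
  have hc := qpow_ne_zero τ γ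
  have h : ∀ m k : ℕ, n = m + k + 1 → (qpow τ γ)⁻¹ ^ m * qpow τ γ ^ (n - 1) = qpow τ γ ^ k := by
    intro m k hk
    rw [show n - 1 = m + k by omega, pow_add, inv_pow]
    field_simp
  simp only [shiftPoly, Polynomial.eval_prod, matsuoCoeff, qpow_neg, Polynomial.eval_add,
    Polynomial.eval_one, Polynomial.eval_mul, Polynomial.eval_C, Polynomial.eval_X]
  -- Reflecting k to n - 1 - k absorbs c^{n-1} and makes the powers of c ascend; the first n - s
  -- factors then occupy the exponents s, …, n - 1.
  rw [Fin.prod_univ_eq_prod_range (fun k => 1 + -(if k < n - s then a else b) *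
    (qpow τ γ)⁻¹ ^ k * (w * qpow τ γ ^ (n - 1))) n, ← Finset.prod_range_reflect]
  obtain ⟨p, hp⟩ := Nat.exists_eq_add_of_le hs
  conv_lhs => enter [1]; rw [hp]
  rw [Finset.prod_range_add, mul_comm]
  refine congrArg₂ _ ?_ ?_
  · rw [show n - s = p by omega]
    refine Finset.prod_congr rfl fun j hj => ?_
    have hj' := Finset.mem_range.mp hj
    have e := h (n - 1 - (s + j)) (s + j) (by omega)
    rw [if_pos (by omega), pow_add] at *
    linear_combination (-a * w) * e
  · refine Finset.prod_congr rfl fun j hj => ?_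
    have hj' := Finset.mem_range.mp hj
    have e := h (n - 1 - j) j (by omega)
    rw [if_neg (by omega)]
    linear_combination (-b * w) * e

variable {τ γ x₁ x₂ β₁ β₂ : ℂ} {n : ℕ}

/-- The scale x₂ in z = x₂ w c^{n-1} is chosen so that x₁ and x₂ enter only through their ratio. -/
lemma shiftPoly_phi_eval (hx₂ : x₂ ≠ 0) {r : ℕ} (hr : r ≤ n) (w : ℂ) :
    (shiftPoly τ γ (n := n) (matsuoCoeff (qpow τ β₂ / x₂) (1 / x₁) r)).eval
        (x₂ * w * qpow τ γ ^ (n - 1)) =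
      poch (qpow τ β₂ * qpow τ γ ^ r * w) (qpow τ γ) (n - r) *
        poch (x₂ / x₁ * w) (qpow τ γ) r := by
  rw [shiftPoly_matsuoCoeff_eval _ _ _ _ hr]
  congr 2
  · field_simp
  · ring

lemma shiftPoly_psi_eval (hx₂ : x₂ ≠ 0) {s : ℕ} (hs : s ≤ n) (w : ℂ) :
    (shiftPoly τ γ (n := n) (matsuoCoeff (qpow τ β₁ / x₁) (1 / x₂) (n - s))).eval
        (x₂ * w * qpow τ γ ^ (n - 1)) =
      poch (qpow τ β₁ * (x₂ / x₁) * qpow τ γ ^ (n - s) * w) (qpow τ γ) s *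
        poch w (qpow τ γ) (n - s) := by
  rw [shiftPoly_matsuoCoeff_eval _ _ _ _ (Nat.sub_le n s), Nat.sub_sub_self hs]
  congr 2
  · ring
  · field_simp

lemma exists_eq_mul_pow (hx₂ : x₂ ≠ 0) (z : ℂ) :
    ∃ w, z = x₂ * w * qpow τ γ ^ (n - 1) := by
  have hc := pow_ne_zero (n - 1) (qpow_ne_zero τ γ)
  exact ⟨z / (x₂ * qpow τ γ ^ (n - 1)), by field_simp⟩

/-- The transition between the numerators of the two bases, at all points `t`. -/
lemma sum_matsuoNum_mul (hx₂ : x₂ ≠ 0)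
    (hγ : ∀ k : ℕ, 1 ≤ k → k ≤ n → qpow τ γ ^ k ≠ 1)
    (hX : ∀ j < n, qpow τ β₂ * qpow τ γ ^ j - x₂ / x₁ ≠ 0)
    (hββ : ∀ i j : ℕ, i < j + n → j < i + n →
      qpow τ β₂ * qpow τ γ ^ i - qpow τ β₁ * (x₂ / x₁) * qpow τ γ ^ j ≠ 0)
    (t : Fin n → ℂ) (s : Fin (n + 1)) :
    ∑ r : Fin (n + 1), matsuoNum τ γ x₂ x₁ β₂ (r : ℕ) t *
        (gaussU τ γ β₁ β₂ (x₂ / x₁) n * gaussD τ γ β₁ β₂ (x₂ / x₁) n *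
          gaussL τ γ β₁ β₂ (x₂ / x₁) n) r s =
      matsuoNum τ γ x₁ x₂ β₁ (n - (s : ℕ)) t := by
  -- One functional serves all the numerators at t, so an identity of polynomials suffices, and it
  -- may be checked pointwise.
  obtain ⟨Λ, hΛ⟩ := altLinear_linear τ γ t
  simp only [matsuoNum_eq_altLinear, hΛ]
  rw [Finset.sum_congr rfl fun r _ => by rw [mul_comm, ← smul_eq_mul, ← map_smul], ← map_sum]
  congr 1
  refine Polynomial.funext fun z => ?_
  obtain ⟨w, rfl⟩ := exists_eq_mul_pow (τ := τ) (γ := γ) (n := n) hx₂ z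
  have hle : ∀ r : Fin (n + 1), (r : ℕ) ≤ n := fun r => Nat.lt_succ_iff.mp r.isLt
  rw [Polynomial.eval_finsetSum, shiftPoly_psi_eval hx₂ (hle s)]
  simp only [Polynomial.eval_smul, smul_eq_mul]
  rw [Finset.sum_congr rfl fun r _ => by rw [shiftPoly_phi_eval hx₂ (hle r)]]
  have hL := sum_mul_gaussL (τ := τ) (γ := γ) (β₁ := β₁) (β₂ := β₂) (hle s) hγ hX
    (fun j k h1 h2 => hββ j k (by omega) (by omega)) (fun j h1 h2 => hββ n j (by omega) (by omega))
    (j := s) rfl w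
  rw [← hL]
  simp only [Matrix.mul_apply, gaussD, Matrix.diagonal_apply, mul_ite, mul_zero,
    Finset.sum_ite_eq', Finset.mem_univ, if_true, Finset.sum_mul]
  rw [Finset.sum_comm]
  refine Finset.sum_congr rfl fun k _ => ?_
  have hU := sum_mul_gaussU (τ := τ) (γ := γ) (β₁ := β₁) (β₂ := β₂) (X := x₂ / x₁) (hle k) hγ
    (fun j h1 => hββ j (n - k) (by omega) (by have := hle k; omega)) (j := k) rfl w
  rw [← hU, Finset.sum_mul, Finset.sum_mul]
  exact Finset.sum_congr rfl fun r _ => by ring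

/-- The functions `φ_0, …, φ_n` are linearly independent. -/
lemma eq_zero_of_sum_phi_mul (hx₁ : x₁ ≠ 0) (hx₂ : x₂ ≠ 0)
    (hγ : ∀ k : ℕ, 1 ≤ k → k ≤ n → qpow τ γ ^ k ≠ 1)
    (hX : ∀ j < n, qpow τ β₂ * qpow τ γ ^ j - x₂ / x₁ ≠ 0) (v : Fin (n + 1) → ℂ)
    (h : ∀ t : Fin n → ℂ, (∀ k, t k ≠ 0 ∧ t k ≠ x₁ ∧ t k ≠ x₂) →
      ∑ r : Fin (n + 1), phi τ γ x₁ x₂ β₁ β₂ (r : ℕ) t * v r = 0) (r : Fin (n + 1)) :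
    v r = 0 := by
  have hc := qpow_ne_zero τ γ
  have hle : ∀ r : Fin (n + 1), (r : ℕ) ≤ n := fun r => Nat.lt_succ_iff.mp r.isLt
  let p : Polynomial ℂ := ∑ r : Fin (n + 1),
    v r • shiftPoly τ γ (n := n) (matsuoCoeff (qpow τ β₂ / x₂) (1 / x₁) (r : ℕ))
  -- The finitely many z for which the progression z c^{-k} may meet 0, x₁ or x₂.
  let E : Set ℂ := {0} ∪ Set.range (fun k : Fin n => x₁ * qpow τ γ ^ (k : ℕ)) ∪
    Set.range (fun k : Fin n => x₂ * qpow τ γ ^ (k : ℕ))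
  have hE : E.Finite :=
    ((Set.finite_singleton _).union (Set.finite_range _)).union (Set.finite_range _)
  have hroot : ∀ z ∈ Eᶜ, p.IsRoot z := by
    intro z hz
    simp only [E, Set.mem_compl_iff, Set.mem_union, Set.mem_singleton_iff, Set.mem_range,
      not_or, not_exists] at hz
    obtain ⟨⟨hz0, hz1⟩, hz2⟩ := hz
    have hne : ∀ (k : Fin n) (x : ℂ), x * qpow τ γ ^ (k : ℕ) ≠ z →
        z * qpow τ (-γ) ^ (k : ℕ) ≠ x := by
      intro k x hx he
      apply hx
      rw [← he, qpow_neg, inv_pow]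
      field_simp
    have ht : ∀ k : Fin n, z * qpow τ (-γ) ^ (k : ℕ) ≠ 0 ∧ z * qpow τ (-γ) ^ (k : ℕ) ≠ x₁ ∧
        z * qpow τ (-γ) ^ (k : ℕ) ≠ x₂ := fun k =>
      ⟨mul_ne_zero hz0 (pow_ne_zero _ (qpow_ne_zero _ _)), hne k _ (hz1 k), hne k _ (hz2 k)⟩
    have ht' : ∀ k : Fin n, 1 - z * qpow τ (-γ) ^ (k : ℕ) / x₂ ≠ 0 ∧
        1 - z * qpow τ (-γ) ^ (k : ℕ) / x₁ ≠ 0 := by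
      intro k
      constructor <;> rw [sub_ne_zero, ne_comm, ne_eq, div_eq_one_iff_eq ‹_›]
      exacts [(ht k).2.2, (ht k).2.1]
    have h0 := h _ ht
    have h1 : p.eval z * deltaGamma τ γ (fun k : Fin n => z * qpow τ (-γ) ^ (k : ℕ)) = 0 := by
      rw [Polynomial.eval_finsetSum, Finset.sum_mul]
      rw [← mul_zero (∏ j : Fin n, (1 - z * qpow τ (-γ) ^ (j : ℕ) / x₂) *
        (1 - z * qpow τ (-γ) ^ (j : ℕ) / x₁)), ← h0, Finset.mul_sum]
      refine Finset.sum_congr rfl fun r _ => ?_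
      rw [phi, psi, ← mul_assoc, ← matsuoNum_eq _ _ _ _ _ _ _ ht', matsuoNum_eq_altLinear,
        altLinear_geometric, Polynomial.eval_smul, smul_eq_mul]
      ring
    exact (mul_eq_zero.mp h1).resolve_right (deltaGamma_geometric_ne_zero τ γ hz0 hγ)
  have hp : p = 0 := Polynomial.eq_zero_of_infinite_isRoot p
    (hE.infinite_compl.mono fun z hz => hroot z hz)
  have hw : ∀ w : ℂ, ∑ r : Fin (n + 1), v r *
      (poch (qpow τ β₂ * qpow τ γ ^ (r : ℕ) * w) (qpow τ γ) (n - r) *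
        poch (x₂ / x₁ * w) (qpow τ γ) r) = 0 := by
    intro w
    have := congrArg (Polynomial.eval (x₂ * w * qpow τ γ ^ (n - 1))) hp
    rw [Polynomial.eval_finsetSum, Polynomial.eval_zero] at this
    rw [← this]
    refine Finset.sum_congr rfl fun r _ => ?_
    rw [Polynomial.eval_smul, smul_eq_mul, shiftPoly_phi_eval hx₂ (hle r)]
  induction hr : (r : ℕ) using Nat.strong_induction_on generalizing r with
  | _ m ih =>
  have hXne : x₂ / x₁ ≠ 0 := div_ne_zero hx₂ hx₁
  have hXw : x₂ / x₁ * (x₂ / x₁ * qpow τ γ ^ m)⁻¹ = (qpow τ γ ^ m)⁻¹ := by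
    rw [mul_inv, mul_inv_cancel_left₀ hXne]
  -- At w = (X c^m)^{-1} the factor (X w; c)_k vanishes for k > m, the terms k < m vanish by
  -- induction, and the genericity conditions keep the polynomial of index m nonzero.
  have h1 := hw (x₂ / x₁ * qpow τ γ ^ m)⁻¹
  rw [Finset.sum_eq_single r] at h1
  · refine (mul_eq_zero.mp h1).resolve_right (mul_ne_zero ?_ ?_)
    · refine Finset.prod_ne_zero_iff.mpr fun j hj => ?_
      have hj' := Finset.mem_range.mp hj
      have := hX j (by omega)
      contrapose! this
      rw [hr] at this
      field_simp at this ⊢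
      linear_combination (-1) * this
    · refine Finset.prod_ne_zero_iff.mpr fun j hj => ?_
      obtain ⟨l, hl⟩ := Nat.exists_eq_add_of_lt (Finset.mem_range.mp hj)
      have := hγ (l + 1) (by omega) (by have := hle r; omega)
      rw [hXw, ← hr, hl]
      contrapose! this
      rw [add_assoc, pow_add, mul_inv, mul_right_comm,
        inv_mul_cancel₀ (pow_ne_zero _ hc), one_mul, sub_eq_zero, eq_comm, inv_eq_one] at this
      exact this
  · intro k _ hk
    rcases lt_or_gt_of_ne (Fin.val_ne_of_ne hk) with hlt | hlt
    · rw [ih k (hr ▸ hlt) k rfl, zero_mul]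
    · have : poch (x₂ / x₁ * (x₂ / x₁ * qpow τ γ ^ m)⁻¹) (qpow τ γ) k = 0 :=
        Finset.prod_eq_zero (Finset.mem_range.mpr (hr ▸ hlt : m < (k : ℕ)))
          (by rw [hXw, inv_mul_cancel₀ (pow_ne_zero _ hc), sub_self])
      rw [this, mul_zero, mul_zero]
  · simp

end TransitionMatrix

/-! ### The matrix R_{2,1}, its uniqueness, and the Jackson integrals. -/

theorem theorem1p3p3 (τ γ x₁ x₂ β₁ β₂ : ℂ) (n : ℕ)
    (hτ : 0 < τ.im) (hx₁ : x₁ ≠ 0) (hx₂ : x₂ ≠ 0)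
    (hγ : ∀ k : ℕ, 1 ≤ k → k ≤ n → qpow τ (k * γ) ≠ 1)
    (hβ₂ : ∀ k : ℕ, k < n → x₂ / x₁ ≠ qpow τ (β₂ + k * γ))
    (hββ : ∀ m : ℤ, |m| < (n : ℤ) → x₂ / x₁ * qpow τ (β₁ - β₂ + m * γ) ≠ 1) :
    -- the matrix `R_{2,1}` exists, is unique, and is the product of the three factors
    (∀ R : Matrix (Fin (n + 1)) (Fin (n + 1)) ℂ,
      IsRMatrix τ γ x₁ x₂ β₁ β₂ n R ↔
        R = gaussU τ γ β₁ β₂ (x₂ / x₁) n * gaussD τ γ β₁ β₂ (x₂ / x₁) n *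
          gaussL τ γ β₁ β₂ (x₂ / x₁) n) ∧
    -- the outer factors are unitriangular
    (∀ r, gaussU τ γ β₁ β₂ (x₂ / x₁) n r r = 1) ∧
    (∀ r s, s < r → gaussU τ γ β₁ β₂ (x₂ / x₁) n r s = 0) ∧
    (∀ r, gaussL τ γ β₁ β₂ (x₂ / x₁) n r r = 1) ∧
    (∀ r s, r < s → gaussL τ γ β₁ β₂ (x₂ / x₁) n r s = 0) ∧
    -- the same matrix relates the Jackson integrals of the two bases
    (∀ (α : ℂ) (u : Fin n → ℂ),
      LatticeAvoidsPoles τ γ x₁ x₂ β₁ β₂ u →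
      (∀ r : Fin (n + 1), JacksonSummable τ (PhiPhi τ γ α x₁ x₂ β₁ β₂ (r : ℕ)) u) →
      ∀ s : Fin (n + 1),
        JacksonSummable τ (PhiPsi τ γ α x₁ x₂ β₁ β₂ (n - (s : ℕ))) u ∧
        ∑ r : Fin (n + 1), jackson τ (PhiPhi τ γ α x₁ x₂ β₁ β₂ (r : ℕ)) u *
            (gaussU τ γ β₁ β₂ (x₂ / x₁) n * gaussD τ γ β₁ β₂ (x₂ / x₁) n *
              gaussL τ γ β₁ β₂ (x₂ / x₁) n) r s
          = jackson τ (PhiPsi τ γ α x₁ x₂ β₁ β₂ (n - (s : ℕ))) u) := by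
  have hγ' : ∀ k : ℕ, 1 ≤ k → k ≤ n → qpow τ γ ^ k ≠ 1 := fun k h1 h2 => by
    rw [← qpow_natCast_mul]
    exact hγ k h1 h2
  have hX : ∀ j < n, qpow τ β₂ * qpow τ γ ^ j - x₂ / x₁ ≠ 0 := fun j hj => by
    rw [← qpow_natCast_mul, ← qpow_add, sub_ne_zero]
    exact (hβ₂ j hj).symm
  have hββ' : ∀ i j : ℕ, i < j + n → j < i + n →
      qpow τ β₂ * qpow τ γ ^ i - qpow τ β₁ * (x₂ / x₁) * qpow τ γ ^ j ≠ 0 := by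
    intro i j h1 h2 h0
    apply hββ ((j : ℤ) - i) (abs_lt.mpr ⟨by omega, by omega⟩)
    have hB := qpow_ne_zero τ β₂
    have hci := pow_ne_zero i (qpow_ne_zero τ γ)
    rw [show β₁ - β₂ + (((j : ℤ) - i : ℤ) : ℂ) * γ = β₁ + j * γ - (β₂ + i * γ) by
      push_cast; ring, qpow_sub, qpow_add, qpow_add, qpow_natCast_mul, qpow_natCast_mul,
      mul_div_assoc', div_eq_one_iff_eq (mul_ne_zero hB hci)]
    linear_combination (-1) * h0
  have hnum := sum_matsuoNum_mul hx₂ hγ' hX hββ'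
  generalize gaussU τ γ β₁ β₂ (x₂ / x₁) n * gaussD τ γ β₁ β₂ (x₂ / x₁) n *
    gaussL τ γ β₁ β₂ (x₂ / x₁) n = T at *
  have hR : IsRMatrix τ γ x₁ x₂ β₁ β₂ n T := by
    intro t ht s
    have h1 : ∀ k, 1 - t k / x₁ ≠ 0 ∧ 1 - t k / x₂ ≠ 0 := by
      intro k
      constructor <;> rw [sub_ne_zero, ne_comm, ne_eq, div_eq_one_iff_eq ‹_›]
      exacts [(ht k).2.1, (ht k).2.2]
    have hne : ∏ j : Fin n, (1 - t j / x₁) * (1 - t j / x₂) ≠ 0 :=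
      Finset.prod_ne_zero_iff.mpr fun j _ => mul_ne_zero (h1 j).1 (h1 j).2
    -- Off the poles the common denominator is invertible, so the identity of numerators is
    -- equivalent to the one wanted.
    apply mul_left_cancel₀ hne
    rw [psi, ← matsuoNum_eq _ _ _ _ _ _ _ h1, ← hnum t s, Finset.mul_sum]
    refine Finset.sum_congr rfl fun r _ => ?_
    rw [phi, psi, ← mul_assoc, matsuoNum_eq τ γ x₂ x₁ β₂ _ _ fun k => (h1 k).symm]
    simp only [mul_comm (1 - t _ / x₁)]
  refine ⟨fun R => ⟨fun h => ?_, fun h => h ▸ hR⟩, fun r => ?_,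
    fun r s h => gaussU_apply_of_lt τ γ β₁ β₂ _ h, fun r => ?_,
    fun r s h => gaussL_apply_of_lt τ γ β₁ β₂ _ h, fun α u _ hsum s => ?_⟩
  · ext r s
    rw [← sub_eq_zero]
    refine eq_zero_of_sum_phi_mul (β₁ := β₁) hx₁ hx₂ hγ' hX (fun r => R r s - T r s) (fun t ht => ?_) r
    simp only [mul_sub, Finset.sum_sub_distrib]
    rw [h t ht s, hR t ht s, sub_self]
  · rw [gaussU_eq τ γ β₁ β₂ _ (r := r) (m := 0) (p := n - r) (by omega) hγ' rfl rfl]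
    simp [gaussBinom_self]
  · rw [gaussL_eq τ γ β₁ β₂ _ (s := r) (l := 0) (k := n - r) (by omega) hγ' rfl rfl]
    simp [gaussBinom_self]
  -- Pointwise identity of the regularised integrands; no point has to be excluded, because the
  -- numerators are polynomials in t.
  · have hint : ∀ u' : Fin n → ℂ, PhiPsi τ γ α x₁ x₂ β₁ β₂ (n - (s : ℕ)) u' =
        ∑ r : Fin (n + 1), PhiPhi τ γ α x₁ x₂ β₁ β₂ (r : ℕ) u' * T r s := by
      intro u'
      rw [PhiPsi, ← hnum, Finset.mul_sum]
      exact Finset.sum_congr rfl fun r _ => by rw [PhiPhi, mul_assoc]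
    have hS : HasSum (fun ν : Fin n → ℤ => PhiPsi τ γ α x₁ x₂ β₁ β₂ (n - (s : ℕ))
        (fun j => u j + 2 * (Real.pi : ℂ) * Complex.I * τ * (ν j : ℂ))) _ :=
      (hasSum_sum fun r (_ : r ∈ Finset.univ) => (hsum r).hasSum.mul_right _).congr_fun
        fun ν => hint _
    refine ⟨hS.summable, ?_⟩
    rw [jackson, hS.tsum_eq, Finset.mul_sum]
    exact Finset.sum_congr rfl fun r _ => by rw [jackson, mul_assoc]
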